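/- Let $\mathbf N=\{1,2,\dots\}$, let $E$ be the complex vector space of columns indexed by $\mathbf N$ with finitely many nonzero entries, with standard basis $(e_n)$, and identify $\mathrm{End}_{\mathbf C}(E)$ with the ring $\mathcal A$ of complex matrices $A=(a_{i,j})_{i,j\in\mathbf N}$ each of whose columns has only finitely many nonzero entries. Let $\mathcal{DR}_0\subseteq\mathcal A$ be the subring of all $A$ for which there are positive real constants $C,c$ such that $a_{i,j}=0$ whenever $i>Cj^c$, and $|a_{i,j}|\le Cj^c$ for all $i,j$. Let $D=(d_{i,j})_{i,j\in\mathbf N}$ be the divisor matrix: $d_{i,j}=1$ if $i$ divides $j$ and $d_{i,j}=0$ otherwise. Let $T=\begin{pmatrix}1&1\\0&1\end{pmatrix}\in \mathrm{SL}(2,\mathbf Z)$. For a sequence $f:\mathbf N\to\mathbf C$ and $A\in\mathcal A$ put $(fA)(n)=\sum_{m}a_{m,n}f(m)$, and let $\mathcal{DS}$ be the space of sequences $f$ with $|f(n)|\le Cn^c$ for all $n$, for some positive constants $C,c$ (equivalently, such that the Dirichlet series $\sum_n f(n)n^{-s}$ converges for some complex $s$). Theorem. There exists a representation $\rho:\mathrm{SL}(2,\mathbf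 Z)\to\mathcal A^\times$ with the following properties. (a) The underlying $\mathbf C\,\mathrm{SL}(2,\mathbf Z)$-module $E$ has an ascending filtration $0=E_0\subset E_1\subset E_2\subset\cdots$ by $\mathbf C\,\mathrm{SL}(2,\mathbf Z)$-submodules with $\bigcup_i E_i=E$, such that for each $i\ge1$ the quotient $E_i/E_{i-1}$ is isomorphic to the standard $2$-dimensional module $\mathbf C^2$ (column vectors, on which $\mathrm{SL}(2,\mathbf Z)$ acts by matrix multiplication). (b) $\rho(T)=D$. (c) $\rho(Y)$ is an integer matrix for every $Y\in\mathrm{SL}(2,\mathbf Z)$. (d) $\rho(\mathrm{SL}(2,\mathbf Z))\subseteq\mathcal{DR}_0$. In particular, $f\mapsto f\rho(Y)$ maps $\mathcal{DS}$ to itself for every $Y\in\mathrm{SL}(2,\mathbf Z)$, so $\mathrm{SL}(2,\mathbf Z)$ acts from the right on analytic Dirichlet series; and $T$ acts as multiplication by $\zeta(s)$: if $\mathrm{Re}(s)>1$ and $\sum_n f(n)n^{-s}$ converges absolutely, then $\sum_n (f\rho(T))(n)n^{-s}$ converges absolutely and equals $\zeta(s)\sum_n f(n)n^{-s}$. -/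

import Mathlib

open scoped MatrixGroups

noncomputable section

namespace DivisorMatrix

/-- The space of finitely supported complex columns indexed by the positive integers. -/
abbrev E : Type := ℕ+ →₀ ℂ

/-- The matrix of an endomorphism of `E` in the standard basis: the `j`-th column is the image of
the `j`-th basis vector. -/
def matrixOf (A : Module.End ℂ E) : Matrix ℕ+ ℕ+ ℂ :=
  Matrix.of fun i j => A (Finsupp.single j 1) i

/-- Each column has only finitely many nonzero entries. -/
def ColumnFinite (M : Matrix ℕ+ ℕ+ ℂ) : Prop :=
  ∀ j, {i | M i j ≠ 0}.Finite

theorem matrixOf_injective : Function.Injective matrixOf := by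
  intro A B h
  refine Finsupp.lhom_ext' fun j => LinearMap.ext_ring ?_
  ext i
  exact congrFun (congrFun h i) j

/-- The matrices of endomorphisms of `E` are exactly the column-finite matrices, so that
`Module.End ℂ E` is identified with the ring of column-finite matrices. -/
theorem range_matrixOf : Set.range matrixOf = {M | ColumnFinite M} := by
  ext M
  constructor
  · rintro ⟨A, rfl⟩ j
    exact (A (Finsupp.single j 1)).hasFiniteSupport
  · intro h
    refine ⟨Finsupp.linearCombination ℂ fun j =>
      Finsupp.ofSupportFinite (fun i => M i j) (h j), ?_⟩
    ext i j
    simp only [matrixOf, Matrix.of_apply, Finsupp.linearCombination_single, one_smul]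
    rfl

/-- Coordinates of `A v`, as a matrix-times-column product. -/
theorem apply_eq_sum (A : Module.End ℂ E) (v : E) (i : ℕ+) :
    A v i = v.sum fun k c => matrixOf A i k * c := by
  have h : A v = v.sum fun k c => c • A (Finsupp.single k 1) := by
    conv_lhs => rw [← Finsupp.sum_single v]
    rw [Finsupp.sum, map_sum]
    refine Finset.sum_congr rfl fun k _ => ?_
    change A _ = v k • A _
    rw [← map_smul, Finsupp.smul_single_one]
  rw [h, Finsupp.sum, Finsupp.finsetSum_apply]
  exact Finset.sum_congr rfl fun k _ => mul_comm _ _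

/-- Composition of endomorphisms is the product of column-finite matrices. -/
theorem matrixOf_mul (A B : Module.End ℂ E) (i j : ℕ+) :
    matrixOf (A * B) i j =
      ∑ k ∈ (B (Finsupp.single j 1)).support, matrixOf A i k * matrixOf B k j :=
  apply_eq_sum A _ i

/-- The divisor matrix. -/
def divisorMatrix : Matrix ℕ+ ℕ+ ℂ :=
  Matrix.of fun i j => if (i : ℕ) ∣ (j : ℕ) then 1 else 0

/-- The right action of endomorphisms of `E` on the dual of `E`, i.e. on sequences `f`:
`(f A)(n) = ∑ m, a m n * f m`, a finite sum. -/
def rightAct (f : ℕ+ → ℂ) (A : Module.End ℂ E) : ℕ+ → ℂ :=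
  fun n => ∑ m ∈ (A (Finsupp.single n 1)).support, matrixOf A m n * f m

/-- Sequences of polynomial growth, i.e. coefficient sequences of analytic Dirichlet series. -/
def DS : Set (ℕ+ → ℂ) :=
  {f | ∃ C > (0 : ℝ), ∃ c > (0 : ℝ), ∀ n : ℕ+, ‖f n‖ ≤ C * (n : ℝ) ^ c}

/-- The sequence `f` as a function on `ℕ` (with value `0` at `0`), so that its Dirichlet series
`∑ n ≥ 1, f n * n ^ (-s)` is `LSeries (coeff f) s`. -/
def coeff (f : ℕ+ → ℂ) : ℕ → ℂ :=
  fun n => if h : 0 < n then f ⟨n, h⟩ else 0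

/-- Polynomially bounded matrices. -/
def PolyBounded (M : Matrix ℕ+ ℕ+ ℂ) : Prop :=
  ∃ C > (0 : ℝ), ∃ c > (0 : ℝ),
    (∀ i j : ℕ+, C * (j : ℝ) ^ c < (i : ℝ) → M i j = 0) ∧
    ∀ i j : ℕ+, ‖M i j‖ ≤ C * (j : ℝ) ^ c

/-- A common enlargement of two bounds. -/
theorem bound_le {C c C' c' : ℝ} (hC : 0 < C) (h : C ≤ C') (h' : c ≤ c') (n : ℕ+) :
    C * (n : ℝ) ^ c ≤ C' * (n : ℝ) ^ c' := by
  have h1 : (1 : ℝ) ≤ (n : ℝ) := by exact_mod_cast (one_le : 1 ≤ n)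
  exact mul_le_mul h (Real.rpow_le_rpow_of_exponent_le h1 h') (by positivity) (by linarith)

theorem PolyBounded.add {M N : Matrix ℕ+ ℕ+ ℂ} (hM : PolyBounded M) (hN : PolyBounded N) :
    PolyBounded (M + N) := by
  obtain ⟨C, hC, c, hc, h1, h2⟩ := hM
  obtain ⟨K, hK, k, hk, h3, h4⟩ := hN
  have e1 := fun j => bound_le (c := c) (c' := c + k) hC (by linarith : C ≤ C + K) (by linarith) j
  have e2 := fun j => bound_le (c := k) (c' := c + k) hK (by linarith : K ≤ C + K) (by linarith) j
  refine ⟨C + K, by positivity, c + k, by positivity, fun i j h => ?_, fun i j => ?_⟩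
  · rw [Matrix.add_apply, h1 i j ((e1 j).trans_lt h), h3 i j ((e2 j).trans_lt h), add_zero]
  · have a1 := h2 i j
    have a2 := h4 i j
    have b1 := bound_le (c := c) (c' := c + k) hC le_rfl (by linarith) j
    have b2 := bound_le (c := k) (c' := c + k) hK le_rfl (by linarith) j
    calc ‖(M + N) i j‖ ≤ ‖M i j‖ + ‖N i j‖ := norm_add_le _ _
      _ ≤ (C + K) * (j : ℝ) ^ (c + k) := by linarith

/-- A finite sum over a set of positive integers that are at most `B`. -/
theorem norm_sum_le (s : Finset ℕ+) (g : ℕ+ → ℂ) {B K : ℝ} (hB : 0 ≤ B) (hK : 0 ≤ K)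
    (h : ∀ k ∈ s, (k : ℝ) ≤ B) (hg : ∀ k ∈ s, ‖g k‖ ≤ K) : ‖∑ k ∈ s, g k‖ ≤ B * K := by
  have hcard : (s.card : ℝ) ≤ B := by
    have hle : s.card ≤ (Finset.Icc 1 ⌊B⌋₊).card := by
      refine Finset.card_le_card_of_injOn (fun k => (k : ℕ)) (fun k hk => ?_)
        (fun a _ b _ hab => PNat.coe_injective hab)
      simpa using ⟨k.pos, Nat.le_floor (h k hk)⟩
    rw [Nat.card_Icc, Nat.add_sub_cancel] at hle
    exact (Nat.cast_le.mpr hle).trans (Nat.floor_le hB)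
  calc ‖∑ k ∈ s, g k‖ ≤ ∑ k ∈ s, K := norm_sum_le_of_le s hg
    _ = s.card * K := by rw [Finset.sum_const, nsmul_eq_mul]
    _ ≤ B * K := by exact mul_le_mul_of_nonneg_right hcard hK

theorem PolyBounded.mul {A B : Module.End ℂ E} (hA : PolyBounded (matrixOf A))
    (hB : PolyBounded (matrixOf B)) : PolyBounded (matrixOf (A * B)) := by
  obtain ⟨C, hC, c, hc, h1, h2⟩ := hA
  obtain ⟨K, hK, κ, hκ, h3, h4⟩ := hB
  have key : ∀ j : ℕ+, 1 ≤ (K + 1) * (j : ℝ) ^ κ ∧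
      C * ((K + 1) * (j : ℝ) ^ κ) ^ (c + 2) =
        C * (K + 1) ^ (c + 2) * (j : ℝ) ^ (κ * (c + 2)) := by
    intro j
    have hj : (1 : ℝ) ≤ (j : ℝ) := by exact_mod_cast (one_le : 1 ≤ j)
    have hjk : (1 : ℝ) ≤ (j : ℝ) ^ κ := Real.one_le_rpow hj hκ.le
    refine ⟨by nlinarith, ?_⟩
    rw [Real.mul_rpow (by positivity) (by positivity), ← Real.rpow_mul (by positivity), mul_assoc]
  have hsupp : ∀ j : ℕ+, ∀ k ∈ (B (Finsupp.single j 1)).support,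
      (k : ℝ) ≤ (K + 1) * (j : ℝ) ^ κ := by
    intro j k hk
    by_contra hlt
    refine Finsupp.mem_support_iff.mp hk (h3 k j ?_)
    exact (bound_le hK (by linarith) le_rfl j).trans_lt (not_le.mp hlt)
  have hCk : ∀ j : ℕ+, ∀ k ∈ (B (Finsupp.single j 1)).support,
      C * (k : ℝ) ^ c ≤ C * ((K + 1) * (j : ℝ) ^ κ) ^ c := fun j k hk =>
    mul_le_mul_of_nonneg_left
      (Real.rpow_le_rpow (by positivity) (hsupp j k hk) hc.le) hC.le
  refine ⟨C * (K + 1) ^ (c + 2), by positivity, κ * (c + 2), by positivity,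
    fun i j hij => ?_, fun i j => ?_⟩
  · obtain ⟨hY, hYeq⟩ := key j
    rw [← hYeq] at hij
    rw [matrixOf_mul]
    refine Finset.sum_eq_zero fun k hk => ?_
    rw [h1 i k, zero_mul]
    refine lt_of_le_of_lt ((hCk j k hk).trans ?_) hij
    exact mul_le_mul_of_nonneg_left
      (Real.rpow_le_rpow_of_exponent_le hY (by linarith)) hC.le
  · obtain ⟨hY, hYeq⟩ := key j
    rw [← hYeq, matrixOf_mul]
    set Y : ℝ := (K + 1) * (j : ℝ) ^ κ with hYdef
    have hY0 : 0 < Y := by linarith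
    have hle := norm_sum_le (B (Finsupp.single j 1)).support
      (fun k => matrixOf A i k * matrixOf B k j) (B := Y) (K := C * Y ^ c * Y)
      hY0.le (by positivity) (hsupp j) (fun k hk => by
        rw [norm_mul]
        refine mul_le_mul ((h2 i k).trans (hCk j k hk)) ((h4 k j).trans ?_)
          (norm_nonneg _) (by positivity)
        exact bound_le hK (by linarith) le_rfl j)
    refine hle.trans (le_of_eq ?_)
    rw [Real.rpow_add hY0, Real.rpow_two]
    ring

/-- The ring of endomorphisms of `E` with polynomially bounded matrices. -/
def DR0 : Subring (Module.End ℂ E) where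
  carrier := {A | PolyBounded (matrixOf A)}
  mul_mem' := PolyBounded.mul
  add_mem' := PolyBounded.add
  one_mem' := by
    refine ⟨1, one_pos, 1, one_pos, fun i j h => ?_, fun i j => ?_⟩
    · have hne : j ≠ i := by
        rintro rfl
        simp at h
      simp [matrixOf, hne]
    · have hj : (1 : ℝ) ≤ (j : ℝ) := by exact_mod_cast (one_le : 1 ≤ j)
      by_cases hij : j = i
      · subst hij
        simpa [matrixOf] using hj
      · simp [matrixOf, hij]
  zero_mem' := by
    refine ⟨1, one_pos, 1, one_pos, fun i j _ => rfl, fun i j => ?_⟩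
    simp [matrixOf]
  neg_mem' := by
    rintro A ⟨C, hC, c, hc, h1, h2⟩
    refine ⟨C, hC, c, hc, fun i j h => ?_, fun i j => ?_⟩
    · have := h1 i j h
      simp only [matrixOf, Matrix.of_apply] at this ⊢
      simp [this]
    · have := h2 i j
      simp only [matrixOf, Matrix.of_apply] at this ⊢
      simpa using this

/-- The standard two-dimensional complex representation of `SL(2, ℤ)`. -/
def standardRep : Representation ℂ SL(2, ℤ) (Fin 2 → ℂ) where
  toFun Y := Matrix.toLin' ((Y : Matrix (Fin 2) (Fin 2) ℤ).map (Int.cast : ℤ → ℂ))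
  map_one' := by simp [Matrix.map_one]; rfl
  map_mul' X Y := by
    rw [Matrix.SpecialLinearGroup.coe_mul]
    change Matrix.toLin' (((X : Matrix (Fin 2) (Fin 2) ℤ) *
      (Y : Matrix (Fin 2) (Fin 2) ℤ)).map (Int.castRingHom ℂ)) = _
    rw [Matrix.map_mul, Matrix.toLin'_mul]
    rfl

/-- The representation on the subquotient `W / U` for subrepresentations `U` and `W`
(used for `U ≤ W`). -/
def subquotient {k G V : Type*} [Field k] [Group G] [AddCommGroup V] [Module k V]
    {ρ : Representation k G V} (U W : Subrepresentation ρ) :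
    Representation k G (W.toSubmodule ⧸ U.toSubmodule.submoduleOf W.toSubmodule) :=
  W.toRepresentation.quotient (U.toSubmodule.submoduleOf W.toSubmodule)
    fun g _ hv => U.apply_mem_toSubmodule g hv

end DivisorMatrix

end

/-!
The operator `N = D - 1` sends `e_n` to the sum of the `e_d` over the proper divisors `d` of `n`.
It is locally nilpotent, and it is surjective because `N e_{2 n} = e_n + (terms of lower index)`
(`divOp_one_mul_dblOp`). The right inverse `R` obtained in this way (`rightInv`) has its image in
the span of the `e_n` for even `n`. Hence `E` is a direct sum of infinite Jordan blocks of `N`, one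
for each odd `m`, with dual basis the functionals `v ↦ (N ^ n v)_m`.

`SL(2, ℤ)` is presented by `s ^ 4 = 1`, `(s t) ^ 3 = s ^ 2` (`exists_hom_of_relations`), so it
suffices to find an operator `S` with `S ^ 2 = -1` and `(S (1 + N)) ^ 3 = -1`. Let
`τ = N ^ 2 / (1 + N)`, so that power series in `N` form a free module with basis `1, N` over power
series in `τ`. Given `S ^ 2 = -1` and that `S` commutes with `τ`, the second relation amounts to
`S N + N S = 1 + τ S`. All this holds for the right action on power series in `N` that is linear
over power series in `τ` and maps `1 ↦ κ N`, `N ↦ -κ⁻¹ = 1 - κ τ`, where `κ` is the power series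
in `τ` with `κ = -1 + κ ^ 2 τ`. Up to signs the coefficients of `κ` are the Catalan numbers; in
particular they are integers. If `σ_n` denotes the image of `N ^ n` under this action, the
corresponding operator on `E` is `S = ∑ R ^ n (1 - R N) σ_n` (`sOp`); the relations are
`sOp_mul_sOp` and `sOp_mul_one_add_pow_three`. All series involved are finite on each vector, so
that `S` preserves the lattice of integer vectors.

For the growth condition `E` is given the norm in which `e_n` has norm `n ^ 3`. Then `N` has norm
at most `1 / 4`, so that `τ`, `κ` and the `σ_n` are bounded uniformly in `n`, and `R` is bounded.
Since `σ_n e_j = 0` once `4 ^ (n / 2) > j`, only `O(log j)` terms of `S e_j` are nonzero, and the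
norm of `S e_j` is polynomial in `j` (`wnorm_opS_single_le`). For integer matrices this bounds the
entries and the lengths of the columns (`polyBounded_of_wnorm_le`).

Finally `τ` commutes with the whole group, and modulo `τ` the two leading coordinates `v_m`,
`(N v)_m` of a Jordan chain transform under the standard representation (`lead_rep_apply`). Ordering
the pairs `(i, m)`, `m` odd, by `2 ^ i * m` and letting `(i, m)` stand for the leading coordinates
of `τ ^ i v` in the chain of `m` gives the filtration (`filt`).
-/

namespace DivisorMatrix

/-! ### A presentation of the modular group -/

/-- If `s ^ 4 = 1` and `(s * t) ^ 3 = s ^ 2` in a group, then every element of the subgroup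
generated by `s` and `t` is, up to a power of the central element `s ^ 2`, of the form `a * w * b`
where `a ∈ {1, s t, (s t)⁻¹}`, `b ∈ {1, s}` and `w` is a word in the positive letters `t` and
`s t⁻¹ s⁻¹`. -/
theorem exists_normal_form {G : Type*} [Group G] {s t : G} (hs : s ^ 4 = 1)
    (hst : (s * t) ^ 3 = s ^ 2) {g : G} (hg : g ∈ Subgroup.closure {s, t}) :
    ∃ (e : ℕ) (a w b : G), (a = 1 ∨ a = s * t ∨ a = (s * t)⁻¹) ∧
      w ∈ Submonoid.closure {t, s * t⁻¹ * s⁻¹} ∧ (b = 1 ∨ b = s) ∧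
      g = (s ^ 2) ^ e * (a * w * b) := by
  set u := s * t with hu
  set z := s ^ 2 with hz
  set r := s * t⁻¹ * s⁻¹ with hr
  have hzs : z * s = s * z := by rw [hz]; group
  have hzu : z * u = u * z := by rw [← hst]; group
  have hzes : ∀ e : ℕ, s * z ^ e = z ^ e * s := fun e =>
    ((show Commute z s from hzs).pow_left e).eq.symm
  have hzeu : ∀ e : ℕ, u * z ^ e = z ^ e * u := fun e =>
    ((show Commute z u from hzu).pow_left e).eq.symm
  have ht : t = s⁻¹ * u := by rw [hu]; group
  -- the set of normal forms is stable under left multiplication by `s` and `u = s * t`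
  let X : G → Prop := fun g => ∃ (e : ℕ) (a w b : G), (a = 1 ∨ a = u ∨ a = u⁻¹) ∧
      w ∈ Submonoid.closure {t, r} ∧ (b = 1 ∨ b = s) ∧ g = z ^ e * (a * w * b)
  have htW : t ∈ Submonoid.closure {t, r} := Submonoid.subset_closure (by simp)
  have hrW : r ∈ Submonoid.closure {t, r} := Submonoid.subset_closure (by simp)
  have e1 : s * u = z * t := by simp only [hu, hz, pow_two, mul_assoc]
  have e2 : s * u⁻¹ = r := by rw [hu, hr]; group
  have e3 : s * r = z * u⁻¹ := by simp only [hr, hu, hz, pow_two, mul_assoc, mul_inv_rev]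
  have e4 : u * u = z * u⁻¹ := by rw [← hst, pow_succ, mul_inv_cancel_right, pow_two]
  have Xs : ∀ g, X g → X (s * g) := by
    rintro g ⟨e, a, w, b, ha, hw, hb, rfl⟩
    rcases ha with rfl | rfl | rfl
    · induction hw using Submonoid.closure_induction_left with
      | one =>
        rcases hb with rfl | rfl
        · exact ⟨e, 1, 1, s, by simp, one_mem _, by simp, by simp [hzes]⟩
        · refine ⟨e + 1, 1, 1, 1, by simp, one_mem _, by simp, ?_⟩
          rw [← mul_assoc, hzes, pow_succ z, hz]
          group
      | mul_left x hx y hy _ =>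
        rcases hx with rfl | rfl
        · exact ⟨e, u, y, b, by simp, hy, hb, by
            rw [← mul_assoc, hzes, mul_assoc]; simp only [hu, one_mul, mul_assoc]⟩
        · refine ⟨e + 1, u⁻¹, y, b, by simp, hy, hb, ?_⟩
          rw [← mul_assoc, hzes, mul_assoc, one_mul, mul_assoc r, ← mul_assoc s, e3, pow_succ]
          simp only [mul_assoc]
    · refine ⟨e + 1, 1, t * w, b, by simp, mul_mem htW hw, hb, ?_⟩
      rw [← mul_assoc, hzes, mul_assoc, mul_assoc u, ← mul_assoc s, e1, pow_succ]
      simp only [mul_assoc, one_mul]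
    · refine ⟨e, 1, r * w, b, by simp, mul_mem hrW hw, hb, ?_⟩
      rw [← mul_assoc, hzes, mul_assoc, mul_assoc u⁻¹, ← mul_assoc s, e2]
      simp only [mul_assoc, one_mul]
  have Xu : ∀ g, X g → X (u * g) := by
    rintro g ⟨e, a, w, b, ha, hw, hb, rfl⟩
    rcases ha with rfl | rfl | rfl
    · exact ⟨e, u, w, b, by simp, hw, hb, by
        rw [← mul_assoc, hzeu, mul_assoc]; simp only [one_mul, mul_assoc]⟩
    · refine ⟨e + 1, u⁻¹, w, b, by simp, hw, hb, ?_⟩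
      rw [← mul_assoc, hzeu, mul_assoc, mul_assoc u, ← mul_assoc u, e4, pow_succ]
      simp only [mul_assoc]
    · refine ⟨e, 1, w, b, by simp, hw, hb, ?_⟩
      rw [← mul_assoc, hzeu, mul_assoc, mul_assoc u⁻¹, mul_inv_cancel_left]
      simp only [one_mul]
  have hs3 : s⁻¹ = s * s * s := by
    rw [inv_eq_iff_mul_eq_one, ← hs]; simp only [pow_succ, pow_zero, one_mul, mul_assoc]
  have hu5 : u⁻¹ = u * u * u * u * u := by
    have : u ^ 6 = 1 := by rw [show 6 = 3 * 2 from rfl, pow_mul, hst, hz, ← pow_mul, ← hs]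
    rw [inv_eq_iff_mul_eq_one, ← this]; simp only [pow_succ, pow_zero, one_mul, mul_assoc]
  have Xs' : ∀ g, X g → X (s⁻¹ * g) := fun g hg => by
    rw [hs3, mul_assoc, mul_assoc]; exact Xs _ (Xs _ (Xs _ hg))
  have Xu' : ∀ g, X g → X (u⁻¹ * g) := fun g hg => by
    rw [hu5]; simp only [mul_assoc]; exact Xu _ (Xu _ (Xu _ (Xu _ (Xu _ hg))))
  change X g
  induction hg using Subgroup.closure_induction_left with
  | one => exact ⟨0, 1, 1, 1, by simp, one_mem _, by simp, by simp⟩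
  | mul_left x hx y _ ih =>
    rcases hx with rfl | rfl
    · exact Xs _ ih
    · rw [ht, mul_assoc]; exact Xs' _ (Xu _ ih)
  | inv_mul_cancel x hx y _ ih =>
    rcases hx with rfl | rfl
    · exact Xs' _ ih
    · rw [ht, mul_inv_rev, inv_inv, mul_assoc]; exact Xu' _ (Xs _ ih)

/-- Words in the positive letters `T` and `S T⁻¹ S⁻¹` have nonnegative entries, and the sum of the
entries detects the empty word. The statement is about words in a product of groups, so that
"empty" refers to both components. -/
theorem positive_word_entries {H : Type*} [Group H] (s t : H) {w : SL(2, ℤ) × H}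
    (hw : w ∈ Submonoid.closure {((ModularGroup.T, t) : SL(2, ℤ) × H),
      (ModularGroup.S, s) * (ModularGroup.T, t)⁻¹ * (ModularGroup.S, s)⁻¹}) :
    (∀ i j, 0 ≤ w.1.1 i j) ∧
      (w = 1 ∨ 3 ≤ w.1.1 0 0 + w.1.1 0 1 + w.1.1 1 0 + w.1.1 1 1) := by
  induction hw using Submonoid.closure_induction_left with
  | one =>
    refine ⟨fun i j => ?_, Or.inl rfl⟩
    fin_cases i <;> fin_cases j <;> simp
  | mul_left x hx y _ ih =>
    obtain ⟨hnn, hsum⟩ := ih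
    have h00 := hnn 0 0
    have h01 := hnn 0 1
    have h10 := hnn 1 0
    have h11 := hnn 1 1
    have hdet := y.1.2
    rw [Matrix.det_fin_two] at hdet
    have hr1 : 1 ≤ y.1.1 1 0 + y.1.1 1 1 := by
      by_contra hlt
      have : y.1.1 1 0 = 0 := by omega
      have : y.1.1 1 1 = 0 := by omega
      simp_all
    have hr0 : 1 ≤ y.1.1 0 0 + y.1.1 0 1 := by
      by_contra hlt
      have : y.1.1 0 0 = 0 := by omega
      have : y.1.1 0 1 = 0 := by omega
      simp_all
    have hsum2 : 2 ≤ y.1.1 0 0 + y.1.1 0 1 + y.1.1 1 0 + y.1.1 1 1 := by omega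
    rcases hx with rfl | rfl
    · have : (((ModularGroup.T, t) : SL(2, ℤ) × H) * y).1.1 = !![1, 1; 0, 1] * y.1.1 := by
        simp [ModularGroup.coe_T]
      rw [this]
      refine ⟨fun i j => ?_, Or.inr ?_⟩
      · fin_cases i <;> fin_cases j <;> simp [Matrix.mul_apply, Fin.sum_univ_two] <;> omega
      · simp [Matrix.mul_apply, Fin.sum_univ_two]; omega
    · have : ((((ModularGroup.S, s) : SL(2, ℤ) × H) * (ModularGroup.T, t)⁻¹ *
          (ModularGroup.S, s)⁻¹) * y).1.1 = !![1, 0; 1, 1] * y.1.1 := by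
        simp [ModularGroup.coe_T, ModularGroup.coe_S, Matrix.SpecialLinearGroup.coe_inv,
          Matrix.adjugate_fin_two]
      rw [this]
      refine ⟨fun i j => ?_, Or.inr ?_⟩
      · fin_cases i <;> fin_cases j <;> simp [Matrix.mul_apply, Fin.sum_univ_two] <;> omega
      · simp [Matrix.mul_apply, Fin.sum_univ_two]; omega

/-- The relations `s ^ 4 = 1` and `(s * t) ^ 3 = s ^ 2` present `SL(2, ℤ)`. -/
theorem exists_hom_of_relations {H : Type*} [Group H] {s t : H} (hs : s ^ 4 = 1)
    (hst : (s * t) ^ 3 = s ^ 2) :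
    ∃ φ : SL(2, ℤ) →* H, φ ModularGroup.S = s ∧ φ ModularGroup.T = t := by
  let σ : SL(2, ℤ) × H := (ModularGroup.S, s)
  let τ : SL(2, ℤ) × H := (ModularGroup.T, t)
  have hS2 : ModularGroup.S ^ 2 = -1 := by
    ext i j; fin_cases i <;> fin_cases j <;> simp [ModularGroup.coe_S, pow_two]
  have hσ : σ ^ 4 = 1 := by
    refine Prod.ext ?_ hs
    change ModularGroup.S ^ 4 = 1
    rw [show 4 = 2 * 2 from rfl, pow_mul, hS2]; simp
  have hστ : (σ * τ) ^ 3 = σ ^ 2 := by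
    refine Prod.ext ?_ hst
    change (ModularGroup.S * ModularGroup.T) ^ 3 = ModularGroup.S ^ 2
    rw [hS2]
    ext i j; fin_cases i <;> fin_cases j <;>
      simp [ModularGroup.coe_S, ModularGroup.coe_T, pow_succ]
  let Γ : Subgroup (SL(2, ℤ) × H) := Subgroup.closure {σ, τ}
  let p : Γ →* SL(2, ℤ) := (MonoidHom.fst _ _).comp Γ.subtype
  -- `Γ` is the graph of the desired homomorphism: it meets `1 × H` trivially
  have key : ∀ g ∈ Γ, g.1 = 1 → g = 1 := by
    intro g hg h1
    obtain ⟨e, a, w, b, ha, hw, hb, rfl⟩ := exists_normal_form hσ hστ hg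
    obtain ⟨hnn, hsum⟩ := positive_word_entries s t hw
    have h00 := hnn 0 0
    have h01 := hnn 0 1
    have h10 := hnn 1 0
    have h11 := hnn 1 1
    have hu : (σ * τ).1.1 = !![0, -1; 1, 1] := by
      simp [σ, τ, ModularGroup.coe_S, ModularGroup.coe_T]
    have hui : (σ * τ)⁻¹.1.1 = !![1, 1; -1, 0] := by
      rw [Prod.fst_inv, Matrix.SpecialLinearGroup.coe_inv, hu, Matrix.adjugate_fin_two]; simp
    have hσm : σ.1.1 = !![0, -1; 1, 0] := by simp [σ, ModularGroup.coe_S]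
    have hz : ((σ ^ 2) ^ e).1 = 1 ∧ (σ ^ 2) ^ e = 1 ∨ ((σ ^ 2) ^ e).1 = -1 := by
      rcases Nat.even_or_odd' e with ⟨k, rfl | rfl⟩
      · left
        have : (σ ^ 2) ^ (2 * k) = 1 := by
          rw [pow_mul, ← pow_mul σ, hσ, one_pow]
        rw [this]; exact ⟨rfl, rfl⟩
      · right
        change (ModularGroup.S ^ 2) ^ (2 * k + 1) = -1
        rw [hS2, pow_succ, pow_mul]; simp
    have hm : (((σ ^ 2) ^ e).1.1 * (a.1.1 * w.1.1 * b.1.1)) = 1 := by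
      have := congrArg Subtype.val h1
      simpa using this
    have hentry : ∀ i j, (((σ ^ 2) ^ e).1.1 * (a.1.1 * w.1.1 * b.1.1)) i j =
        (1 : Matrix (Fin 2) (Fin 2) ℤ) i j := fun i j => by rw [hm]
    have k00 := hentry 0 0
    have k01 := hentry 0 1
    have k10 := hentry 1 0
    have k11 := hentry 1 1
    -- unless `a = b = 1` and the sign is `+`, the matrix of `w` would have to be `±` a matrix with
    -- entries of both signs, or `-1`
    rcases hz with ⟨hz, hz1⟩ | hz <;> rw [hz] at k00 k01 k10 k11 <;>
      rcases ha with rfl | rfl | rfl <;> rcases hb with rfl | rfl <;>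
      simp only [hu, hui, hσm, Prod.fst_one, Matrix.SpecialLinearGroup.coe_one,
        Matrix.SpecialLinearGroup.coe_neg, one_mul, mul_one, Matrix.neg_apply,
        Matrix.mul_apply, Fin.sum_univ_two, Matrix.of_apply, Matrix.cons_val_zero,
        Matrix.cons_val_one, Matrix.cons_val', Matrix.one_apply_eq, Matrix.one_apply_ne,
        Matrix.empty_val', Matrix.cons_val_fin_one, ne_eq, zero_ne_one, one_ne_zero,
        not_false_eq_true] at k00 k01 k10 k11 <;> try omega
    rcases hsum with rfl | hsum
    · rw [hz1]; simp
    · omega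
  have hinj : Function.Injective p := by
    rw [injective_iff_map_eq_one]
    exact fun g hg => Subtype.ext (key g.1 g.2 hg)
  have hsurj : Function.Surjective p := by
    rw [← MonoidHom.range_eq_top, eq_top_iff, ← SpecialLinearGroup.SL2Z_generators,
      Subgroup.closure_le]
    rintro _ (rfl | rfl)
    · exact ⟨⟨σ, Subgroup.subset_closure (by simp)⟩, rfl⟩
    · exact ⟨⟨τ, Subgroup.subset_closure (by simp)⟩, rfl⟩
  let ε := MulEquiv.ofBijective p ⟨hinj, hsurj⟩
  refine ⟨((MonoidHom.snd _ _).comp Γ.subtype).comp ε.symm.toMonoidHom, ?_, ?_⟩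
  · have : ε.symm ModularGroup.S = ⟨σ, Subgroup.subset_closure (by simp)⟩ :=
      ε.symm_apply_eq.mpr rfl
    simp [this, σ]
  · have : ε.symm ModularGroup.T = ⟨τ, Subgroup.subset_closure (by simp)⟩ :=
      ε.symm_apply_eq.mpr rfl
    simp [this, τ]

/-- `S` and `T` generate `SL(2, ℤ)` already as a monoid, since both have inverses among their
positive words. -/
theorem induction_S_T {p : SL(2, ℤ) → Prop} (one : p 1) (mul : ∀ X Y, p X → p Y → p (X * Y))
    (hS : p ModularGroup.S) (hT : p ModularGroup.T) (Y : SL(2, ℤ)) : p Y := by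
  have hSi : (ModularGroup.S)⁻¹ = ModularGroup.S * ModularGroup.S * ModularGroup.S := by
    ext i j; fin_cases i <;> fin_cases j <;> simp [ModularGroup.coe_S, Matrix.adjugate_fin_two]
  have hTi : (ModularGroup.T)⁻¹ = ModularGroup.S * ModularGroup.T * ModularGroup.S *
      ModularGroup.T * (ModularGroup.S * ModularGroup.S * ModularGroup.S) := by
    ext i j; fin_cases i <;> fin_cases j <;>
      simp [ModularGroup.coe_S, ModularGroup.coe_T, Matrix.adjugate_fin_two]
  have hY : Y ∈ Subgroup.closure {ModularGroup.S, ModularGroup.T} := by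
    rw [SpecialLinearGroup.SL2Z_generators]; trivial
  have hSS := mul _ _ (mul _ _ hS hS) hS
  have hSi' : p (ModularGroup.S)⁻¹ := by rw [hSi]; exact hSS
  have hTi' : p (ModularGroup.T)⁻¹ := by
    rw [hTi]; exact mul _ _ (mul _ _ (mul _ _ (mul _ _ hS hT) hS) hT) hSS
  induction hY using Subgroup.closure_induction_left with
  | one => exact one
  | mul_left x hx y _ ih =>
    rcases hx with rfl | rfl
    · exact mul _ _ hS ih
    · exact mul _ _ hT ih
  | inv_mul_cancel x hx y _ ih =>
    rcases hx with rfl | rfl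
    · exact mul _ _ hSi' ih
    · exact mul _ _ hTi' ih

/-! ### Locally stationary limits of operators -/

section LocLim

variable {k M : Type*} [CommRing k] [AddCommGroup M] [Module k M]

/-- `A` is the limit of `f` in the topology of pointwise convergence, the module being discrete: on
each vector, `f` is eventually constant with value given by `A`. -/
def IsLocLim (f : ℕ → Module.End k M) (A : Module.End k M) : Prop :=
  ∀ v, ∀ᶠ n in Filter.atTop, f n v = A v

theorem exists_isLocLim {f : ℕ → Module.End k M}
    (h : ∀ v, ∃ w, ∀ᶠ n in Filter.atTop, f n v = w) : ∃ A, IsLocLim f A := by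
  choose g hg using h
  refine ⟨{ toFun := g, map_add' := fun v w => ?_, map_smul' := fun c v => ?_ }, hg⟩
  · obtain ⟨k, h1, h2, h3⟩ := ((hg (v + w)).and ((hg v).and (hg w))).exists
    rw [← h1, ← h2, ← h3, map_add]
  · obtain ⟨k, h1, h2⟩ := ((hg (c • v)).and (hg v)).exists
    rw [← h1, ← h2, map_smul, RingHom.id_apply]

open Classical in
/-- The locally stationary limit of a sequence of operators, `0` if there is none. -/
noncomputable def locLim (f : ℕ → Module.End k M) : Module.End k M :=
  if h : ∃ A, IsLocLim f A then h.choose else 0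

theorem isLocLim_locLim {f : ℕ → Module.End k M}
    (h : ∀ v, ∃ w, ∀ᶠ n in Filter.atTop, f n v = w) : IsLocLim f (locLim f) := by
  rw [locLim, dif_pos (exists_isLocLim h)]
  exact (exists_isLocLim h).choose_spec

namespace IsLocLim

variable {f g : ℕ → Module.End k M} {A B : Module.End k M}

theorem const (A : Module.End k M) : IsLocLim (fun _ => A) A :=
  fun _ => Filter.Eventually.of_forall fun _ => rfl

theorem unique (hA : IsLocLim f A) (hB : IsLocLim f B) : A = B :=
  LinearMap.ext fun v => by
    obtain ⟨k, h1, h2⟩ := ((hA v).and (hB v)).exists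
    rw [← h1, h2]

theorem add (hA : IsLocLim f A) (hB : IsLocLim g B) : IsLocLim (fun n => f n + g n) (A + B) :=
  fun v => by
    filter_upwards [hA v, hB v] with k h1 h2
    rw [LinearMap.add_apply, LinearMap.add_apply, h1, h2]

theorem mul (hA : IsLocLim f A) (hB : IsLocLim g B) : IsLocLim (fun n => f n * g n) (A * B) :=
  fun v => by
    filter_upwards [hA (B v), hB v] with k h1 h2
    rw [Module.End.mul_apply, Module.End.mul_apply, h2, h1]

theorem succ (hA : IsLocLim f A) : IsLocLim (fun n => f (n + 1)) A :=
  fun v => (Filter.tendsto_add_atTop_nat 1).eventually (hA v)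

theorem commute (hA : IsLocLim f A) (h : ∀ n, Commute (f n) B) : Commute A B := by
  refine ((hA.mul (const B)).unique (f := fun n => f n * B) ?_)
  simp_rw [fun k => (h k).eq]
  exact (const B).mul hA

theorem mem_of_forall_mem (hA : IsLocLim f A) {v : M} {W : Set M} (h : ∀ n, f n v ∈ W) :
    A v ∈ W := by
  obtain ⟨k, hk⟩ := (hA v).exists
  rw [← hk]
  exact h k

end IsLocLim

/-- The subring of operators that map a subgroup of the module into itself. -/
def stab (W : AddSubgroup M) : Subring (Module.End k M) where
  carrier := {A | ∀ v ∈ W, A v ∈ W}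
  mul_mem' hA hB v hv := hA _ (hB v hv)
  add_mem' hA hB v hv := W.add_mem (hA v hv) (hB v hv)
  one_mem' _ hv := hv
  zero_mem' _ _ := W.zero_mem
  neg_mem' hA v hv := W.neg_mem (hA v hv)

theorem IsLocLim.mem_stab {f : ℕ → Module.End k M} {A : Module.End k M} (hA : IsLocLim f A)
    {W : AddSubgroup M} (h : ∀ n, f n ∈ stab W) : A ∈ stab W :=
  fun v hv => hA.mem_of_forall_mem (W := W) fun k => h k v hv

/-- The geometric series `∑ X ^ i`, for a locally nilpotent operator `X`. -/
noncomputable def geom (X : Module.End k M) : Module.End k M :=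
  locLim fun n => ∑ i ∈ Finset.range n, X ^ i

theorem pow_apply_eq_zero_of_le {X : Module.End k M} {v : M} {m n : ℕ} (h : (X ^ m) v = 0)
    (hmn : m ≤ n) : (X ^ n) v = 0 := by
  obtain ⟨d, rfl⟩ := Nat.exists_eq_add_of_le' hmn
  rw [pow_add, Module.End.mul_apply, h, map_zero]

theorem sum_range_eventually_const {f : ℕ → Module.End k M} {v : M} {m : ℕ}
    (h : ∀ i, m ≤ i → f i v = 0) {n : ℕ} (hn : m ≤ n) :
    (∑ i ∈ Finset.range n, f i) v = (∑ i ∈ Finset.range m, f i) v := by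
  rw [LinearMap.sum_apply, LinearMap.sum_apply]
  refine (Finset.sum_subset (Finset.range_mono hn) fun k _ hk => h k ?_).symm
  simpa using hk

section Geom

variable {X : Module.End k M} (hX : ∀ v, ∃ m, (X ^ m) v = 0)
include hX

theorem isLocLim_geom : IsLocLim (fun n => ∑ i ∈ Finset.range n, X ^ i) (geom X) :=
  isLocLim_locLim fun v => by
    obtain ⟨m, hm⟩ := hX v
    refine ⟨_, Filter.eventually_atTop.mpr ⟨m, fun n hn =>
      sum_range_eventually_const (fun k hk => pow_apply_eq_zero_of_le hm hk) hn⟩⟩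

theorem isLocLim_pow : IsLocLim (fun n => 1 - X ^ n) 1 := fun v => by
  obtain ⟨m, hm⟩ := hX v
  refine Filter.eventually_atTop.mpr ⟨m, fun n hn => ?_⟩
  rw [LinearMap.sub_apply, pow_apply_eq_zero_of_le hm hn, sub_zero]

theorem geom_mul : geom X * (1 - X) = 1 := by
  refine ((isLocLim_geom hX).mul (IsLocLim.const _)).unique ?_
  simp_rw [geom_sum_mul_neg]
  exact isLocLim_pow hX

theorem mul_geom : (1 - X) * geom X = 1 := by
  refine ((IsLocLim.const _).mul (isLocLim_geom hX)).unique ?_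
  simp_rw [mul_neg_geom_sum]
  exact isLocLim_pow hX

theorem commute_geom {A : Module.End k M} (hA : Commute X A) : Commute (geom X) A :=
  (isLocLim_geom hX).commute fun _ => Commute.sum_left _ _ _ fun _ _ => hA.pow_left _

theorem geom_mem_stab {W : AddSubgroup M} (hW : X ∈ stab W) : geom X ∈ stab W :=
  (isLocLim_geom hX).mem_stab fun _ => sum_mem fun _ _ => pow_mem hW _

end Geom

end LocLim

/-! ### A weighted norm -/

/-- The weighted `ℓ¹` norm on `E` in which `e_n` has norm `n ^ 3`. -/
noncomputable def wnorm (v : E) : ℝ := v.sum fun n c => ‖c‖ * (n : ℝ) ^ 3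

theorem wnorm_eq_sum {v : E} {s : Finset ℕ+} (h : v.support ⊆ s) :
    wnorm v = ∑ n ∈ s, ‖v n‖ * (n : ℝ) ^ 3 :=
  Finsupp.sum_of_support_subset _ h _ fun _ _ => by simp

theorem wnorm_nonneg (v : E) : 0 ≤ wnorm v :=
  Finset.sum_nonneg fun _ _ => by positivity

@[simp]
theorem wnorm_zero : wnorm 0 = 0 := Finsupp.sum_zero_index

theorem wnorm_add_le (v w : E) : wnorm (v + w) ≤ wnorm v + wnorm w := by
  classical
  rw [wnorm_eq_sum (Finsupp.support_add (g₁ := v) (g₂ := w)),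
    wnorm_eq_sum (v := v) Finset.subset_union_left,
    wnorm_eq_sum (v := w) Finset.subset_union_right, ← Finset.sum_add_distrib]
  refine Finset.sum_le_sum fun n _ => ?_
  rw [← add_mul]
  gcongr
  exact norm_add_le _ _

theorem wnorm_smul (c : ℂ) (v : E) : wnorm (c • v) = ‖c‖ * wnorm v := by
  rw [wnorm_eq_sum (Finsupp.support_smul (b := c) (g := v)), wnorm_eq_sum subset_rfl,
    Finset.mul_sum]
  refine Finset.sum_congr rfl fun n _ => ?_
  rw [Finsupp.smul_apply, norm_smul, mul_assoc]

theorem wnorm_neg (v : E) : wnorm (-v) = wnorm v := by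
  rw [← neg_one_smul ℂ, wnorm_smul]; simp

theorem wnorm_single (n : ℕ+) (c : ℂ) : wnorm (Finsupp.single n c) = ‖c‖ * (n : ℝ) ^ 3 :=
  Finsupp.sum_single_index (by simp)

theorem wnorm_sum_le {ι : Type*} (s : Finset ι) (f : ι → E) :
    wnorm (∑ i ∈ s, f i) ≤ ∑ i ∈ s, wnorm (f i) :=
  Finset.le_sum_of_subadditive wnorm wnorm_zero.le wnorm_add_le s f

theorem norm_apply_mul_le_wnorm (v : E) (n : ℕ+) : ‖v n‖ * (n : ℝ) ^ 3 ≤ wnorm v := by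
  classical
  rw [wnorm_eq_sum (Finset.subset_insert n v.support)]
  exact Finset.single_le_sum (f := fun n : ℕ+ => ‖v n‖ * (n : ℝ) ^ 3)
    (fun _ _ => by positivity) (Finset.mem_insert_self n _)

/-- `A` has operator norm at most `B` for the weighted norm. -/
def OpBound (A : Module.End ℂ E) (B : ℝ) : Prop := ∀ v, wnorm (A v) ≤ B * wnorm v

theorem map_eq_sum (A : Module.End ℂ E) (v : E) :
    A v = ∑ n ∈ v.support, v n • A (Finsupp.single n 1) := by
  conv_lhs => rw [← Finsupp.sum_single v, Finsupp.sum, map_sum]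
  refine Finset.sum_congr rfl fun n _ => ?_
  rw [← map_smul, Finsupp.smul_single_one]

namespace OpBound

variable {A A' : Module.End ℂ E} {B B' : ℝ}

theorem of_single (h : ∀ n, wnorm (A (Finsupp.single n 1)) ≤ B * (n : ℝ) ^ 3) :
    OpBound A B := fun v => by
  rw [map_eq_sum, wnorm_eq_sum (v := v) subset_rfl, Finset.mul_sum]
  refine (wnorm_sum_le _ _).trans (Finset.sum_le_sum fun n _ => ?_)
  rw [wnorm_smul, mul_left_comm]
  exact mul_le_mul_of_nonneg_left (h n) (norm_nonneg _)

theorem mono (h : OpBound A B) (hB : B ≤ B') : OpBound A B' := fun v =>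
  (h v).trans (mul_le_mul_of_nonneg_right hB (wnorm_nonneg v))

theorem one : OpBound 1 1 := fun v => by simp

theorem neg (h : OpBound A B) : OpBound (-A) B := fun v => by
  rw [LinearMap.neg_apply, wnorm_neg]; exact h v

theorem add (h : OpBound A B) (h' : OpBound A' B') : OpBound (A + A') (B + B') := fun v => by
  rw [LinearMap.add_apply, add_mul]
  exact (wnorm_add_le _ _).trans (add_le_add (h v) (h' v))

theorem sub (h : OpBound A B) (h' : OpBound A' B') : OpBound (A - A') (B + B') := by
  rw [sub_eq_add_neg (G := Module.End ℂ E)]; exact h.add h'.neg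

theorem mul (h : OpBound A B) (h' : OpBound A' B') (hB : 0 ≤ B) : OpBound (A * A') (B * B') :=
  fun v => by
    rw [Module.End.mul_apply, mul_assoc]
    exact (h _).trans (mul_le_mul_of_nonneg_left (h' v) hB)

theorem pow (h : OpBound A B) (hB : 0 ≤ B) (n : ℕ) : OpBound (A ^ n) (B ^ n) := by
  induction n with
  | zero => simpa using one
  | succ n ih => rw [pow_succ, pow_succ]; exact ih.mul h (by positivity)

theorem sum {ι : Type*} {s : Finset ι} {f : ι → Module.End ℂ E} {b : ι → ℝ}
    (h : ∀ i ∈ s, OpBound (f i) (b i)) : OpBound (∑ i ∈ s, f i) (∑ i ∈ s, b i) := fun v => by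
  rw [LinearMap.sum_apply, Finset.sum_mul]
  exact (wnorm_sum_le _ _).trans (Finset.sum_le_sum fun i hi => h i hi v)

theorem of_isLocLim {f : ℕ → Module.End ℂ E} (hA : IsLocLim f A) (h : ∀ k, OpBound (f k) B) :
    OpBound A B := fun v =>
  hA.mem_of_forall_mem (W := {w | wnorm w ≤ B * wnorm v}) fun k => h k v

theorem geom (hX : ∀ v, ∃ m, (A ^ m) v = 0) (h : OpBound A B) (hB : 0 ≤ B) (hB1 : B < 1) :
    OpBound (geom A) (1 - B)⁻¹ :=
  of_isLocLim (isLocLim_geom hX) fun n =>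
    (sum fun k _ => h.pow hB k).mono (by
      rw [← tsum_geometric_of_lt_one hB hB1]
      exact (summable_geometric_of_lt_one hB hB1).sum_le_tsum _ fun _ _ => by positivity)

end OpBound

/-! ### Supports and integrality -/

/-- The vectors supported on indices `j` with `c * j ≤ x`. -/
def Lev (c x : ℕ) : Submodule ℂ E := Finsupp.supported ℂ ℂ {j : ℕ+ | c * (j : ℕ) ≤ x}

theorem mem_Lev {c x : ℕ} {v : E} : v ∈ Lev c x ↔ ∀ j, v j ≠ 0 → c * (j : ℕ) ≤ x := by
  rw [Lev, Finsupp.mem_supported]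
  simp [Set.subset_def]

theorem single_mem_Lev {c x : ℕ} {n : ℕ+} (h : c * (n : ℕ) ≤ x) (a : ℂ) :
    Finsupp.single n a ∈ Lev c x := Finsupp.single_mem_supported ℂ a h

theorem map_mem_of_mem_Lev {A : Module.End ℂ E} {c x : ℕ} {W : Submodule ℂ E}
    (h : ∀ n : ℕ+, c * (n : ℕ) ≤ x → A (Finsupp.single n 1) ∈ W) {v : E} (hv : v ∈ Lev c x) :
    A v ∈ W := by
  rw [map_eq_sum]
  exact W.sum_mem fun n hn => W.smul_mem _ (h n (mem_Lev.mp hv n (by simpa using hn)))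

theorem exists_mem_Lev (v : E) : ∃ x, v ∈ Lev 1 x := by
  refine ⟨v.support.sup fun j => (j : ℕ), mem_Lev.mpr fun j hj => ?_⟩
  rw [one_mul]
  exact Finset.le_sup (f := fun j : ℕ+ => (j : ℕ)) (by simpa using hj)

theorem eq_zero_of_mem_Lev {c x : ℕ} (h : x < c) {v : E} (hv : v ∈ Lev c x) : v = 0 := by
  ext j
  by_contra hj
  have := mem_Lev.mp hv j hj
  have := Nat.le_mul_of_pos_right c j.pos
  omega

/-- The vectors with integer coordinates. -/
def intLattice : AddSubgroup E where
  carrier := {v | ∀ i, ∃ z : ℤ, v i = z}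
  add_mem' := fun {v w} hv hw i => by
    obtain ⟨a, ha⟩ := hv i
    obtain ⟨b, hb⟩ := hw i
    exact ⟨a + b, by simp [ha, hb]⟩
  zero_mem' := fun i => ⟨0, by simp⟩
  neg_mem' := fun {v} hv i => by
    obtain ⟨a, ha⟩ := hv i
    exact ⟨-a, by simp [ha]⟩

theorem single_mem_intLattice (n : ℕ+) : (Finsupp.single n 1 : E) ∈ intLattice := fun i => by
  classical
  by_cases h : n = i
  · exact ⟨1, by simp [h]⟩
  · exact ⟨0, by simp [h]⟩

theorem mem_stab_intLattice {A : Module.End ℂ E}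
    (h : ∀ n, A (Finsupp.single n 1) ∈ intLattice) : A ∈ stab intLattice := fun v hv => by
  rw [map_eq_sum]
  refine sum_mem fun n _ => ?_
  obtain ⟨z, hz⟩ := hv n
  rw [hz, Int.cast_smul_eq_zsmul]
  exact zsmul_mem (h n) z

/-- Integer operators that increase the weighted norm only polynomially are polynomially bounded:
a nonzero integer has absolute value at least `1`, so the bound on the entries also bounds the
length of the columns. -/
theorem polyBounded_of_wnorm_le {A : Module.End ℂ E} (hA : A ∈ stab intLattice) {C c : ℝ}
    (hC : 0 < C) (hc : 0 < c)
    (h : ∀ n : ℕ+, wnorm (A (Finsupp.single n 1)) ≤ C * (n : ℝ) ^ c) :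
    PolyBounded (matrixOf A) := by
  have key : ∀ i j : ℕ+, ‖matrixOf A i j‖ * (i : ℝ) ^ 3 ≤ C * (j : ℝ) ^ c := fun i j =>
    (norm_apply_mul_le_wnorm _ i).trans (h j)
  have hi1 : ∀ i : ℕ+, (1 : ℝ) ≤ (i : ℝ) := fun i => by exact_mod_cast (one_le : 1 ≤ i)
  refine ⟨C, hC, c, hc, fun i j hij => ?_, fun i j => ?_⟩
  · by_contra hne
    obtain ⟨z, hz⟩ := hA _ (single_mem_intLattice j) i
    change matrixOf A i j = z at hz
    have hz0 : z ≠ 0 := by rintro rfl; exact hne (by simpa using hz)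
    have h1 : (1 : ℝ) ≤ ‖matrixOf A i j‖ := by
      rw [hz, Complex.norm_intCast]
      exact_mod_cast Int.one_le_abs hz0
    have h2 : (i : ℝ) ≤ (i : ℝ) ^ 3 := le_self_pow₀ (hi1 i) (by norm_num)
    have h3 : (i : ℝ) ^ 3 ≤ ‖matrixOf A i j‖ * (i : ℝ) ^ 3 :=
      le_mul_of_one_le_left (by positivity) h1
    linarith [key i j]
  · exact (le_mul_of_one_le_right (norm_nonneg _) (one_le_pow₀ (hi1 i))).trans (key i j)

/-! ### The operator representing `S` -/

section Construction

variable {k M : Type*} [CommRing k] [AddCommGroup M] [Module k M]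

/-- `N ^ 2 / (1 + N)`. If `T` acts as `1 + N`, this is `T + T⁻¹ - 2`. -/
noncomputable def tauOp (N : Module.End k M) : Module.End k M := N * N * geom (-N)

/-- Successive approximations, by polynomials in `τ`, to the solution of `x = -1 + x ^ 2 τ`. -/
noncomputable def kappaSeq (τ : Module.End k M) : ℕ → Module.End k M
  | 0 => -1
  | n + 1 => -1 + kappaSeq τ n * kappaSeq τ n * τ

/-- The solution of `x = -1 + x ^ 2 τ` that is a power series in `τ`; up to signs its coefficients
are the Catalan numbers. -/
noncomputable def kappaOp (τ : Module.End k M) : Module.End k M := locLim (kappaSeq τ)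

/-- The image of `N ^ n` under the right action of `S` on power series in `N`. This action is
linear over power series in `τ`, with `1 ↦ κ N` and `N ↦ 1 - κ τ = -κ⁻¹`. -/
noncomputable def sigmaOp (N : Module.End k M) : ℕ → Module.End k M
  | 0 => kappaOp (tauOp N) * N
  | 1 => 1 - kappaOp (tauOp N) * tauOp N
  | n + 2 => (sigmaOp N (n + 1) + sigmaOp N n) * tauOp N

/-- For a locally nilpotent operator `N` with right inverse `R`, the operator that will represent
`S` when `1 + N` represents `T`. Here `1 - R N` is the projection to the kernel of `N` along the
image of `R`, and every vector `v` is `∑ R ^ n (1 - R N) N ^ n v`. -/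
noncomputable def sOp (N R : Module.End k M) : Module.End k M :=
  locLim fun n => ∑ i ∈ Finset.range n, R ^ i * (1 - R * N) * sigmaOp N i

section Kappa

variable {τ : Module.End k M}

theorem commute_kappaSeq {A : Module.End k M} (h : Commute τ A) (n : ℕ) :
    Commute (kappaSeq τ n) A := by
  induction n with
  | zero => exact (Commute.one_left A).neg_left
  | succ n ih => exact (Commute.one_left A).neg_left.add_left ((ih.mul_left ih).mul_left h)

theorem kappaSeq_succ_apply (n : ℕ) {v : M} (hv : (τ ^ n) v = 0) :
    kappaSeq τ (n + 1) v = kappaSeq τ n v := by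
  induction n generalizing v with
  | zero => rw [show v = 0 by simpa using hv, map_zero, map_zero]
  | succ n ih =>
    have h1 : (τ ^ n) (τ v) = 0 := by rwa [pow_succ] at hv
    have h2 : (τ ^ n) (kappaSeq τ n (τ v)) = 0 := by
      rw [← Module.End.mul_apply, ((commute_kappaSeq (Commute.refl τ) n).pow_right n).eq.symm,
        Module.End.mul_apply, h1, map_zero]
    change -v + kappaSeq τ (n + 1) (kappaSeq τ (n + 1) (τ v)) =
      -v + kappaSeq τ n (kappaSeq τ n (τ v))
    rw [ih h1, ih h2]

variable (hτ : ∀ v, ∃ m, (τ ^ m) v = 0)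
include hτ

theorem isLocLim_kappaSeq : IsLocLim (kappaSeq τ) (kappaOp τ) :=
  isLocLim_locLim fun v => by
    obtain ⟨m, hm⟩ := hτ v
    refine ⟨kappaSeq τ m v, Filter.eventually_atTop.mpr ⟨m, fun n hn => ?_⟩⟩
    induction n, hn using Nat.le_induction with
    | base => rfl
    | succ n hn ih => rw [kappaSeq_succ_apply n (pow_apply_eq_zero_of_le hm hn), ih]

theorem commute_kappaOp {A : Module.End k M} (h : Commute τ A) : Commute (kappaOp τ) A :=
  (isLocLim_kappaSeq hτ).commute (commute_kappaSeq h)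

theorem kappaOp_eq : kappaOp τ = -1 + kappaOp τ * kappaOp τ * τ :=
  (isLocLim_kappaSeq hτ).succ.unique ((IsLocLim.const _).add
    (((isLocLim_kappaSeq hτ).mul (isLocLim_kappaSeq hτ)).mul (IsLocLim.const _)))

theorem kappaOp_mem_stab {W : AddSubgroup M} (h : τ ∈ stab W) : kappaOp τ ∈ stab W :=
  (isLocLim_kappaSeq hτ).mem_stab fun n => by
    induction n with
    | zero => exact neg_mem (one_mem _)
    | succ n ih => exact add_mem (neg_mem (one_mem _)) (mul_mem (mul_mem ih ih) h)

end Kappa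

variable {N R : Module.End k M}

theorem sigmaOp_apply_eq_zero {i n : ℕ} (hn : 2 * i ≤ n) {v : M} (hv : (tauOp N ^ i) v = 0) :
    sigmaOp N n v = 0 := by
  induction i generalizing n v with
  | zero => rw [show v = 0 by simpa using hv, map_zero]
  | succ i ih =>
    obtain ⟨n, rfl⟩ := Nat.exists_eq_add_of_le' (show 2 ≤ n by omega)
    have h1 : (tauOp N ^ i) (tauOp N v) = 0 := by rwa [pow_succ] at hv
    change sigmaOp N (n + 1) (tauOp N v) + sigmaOp N n (tauOp N v) = 0
    rw [ih (by omega) h1, ih (by omega) h1, add_zero]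

variable (hN : ∀ v, ∃ m, (N ^ m) v = 0)
include hN

theorem neg_pow_apply_eq_zero (v : M) : ∃ m, ((-N) ^ m) v = 0 := by
  obtain ⟨m, hm⟩ := hN v
  refine ⟨m, ?_⟩
  rw [neg_pow, Module.End.mul_apply, hm, map_zero]

theorem one_add_mul_geom : (1 + N) * geom (-N) = 1 := by
  have := mul_geom (neg_pow_apply_eq_zero hN)
  rwa [sub_neg_eq_add] at this

theorem geom_mul_one_add : geom (-N) * (1 + N) = 1 := by
  have := geom_mul (neg_pow_apply_eq_zero hN)
  rwa [sub_neg_eq_add] at this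

theorem commute_geom_neg : Commute (geom (-N)) N :=
  commute_geom (neg_pow_apply_eq_zero hN) (Commute.refl N).neg_left

theorem commute_tauOp : Commute (tauOp N) N :=
  ((Commute.refl N).mul_left (Commute.refl N)).mul_left (commute_geom_neg hN)

theorem tauOp_mul_one_add : tauOp N * (1 + N) = N * N := by
  rw [tauOp, mul_assoc, geom_mul_one_add hN, mul_one]

theorem one_add_mul_tauOp : (1 + N) * tauOp N = N * N := by
  rw [← tauOp_mul_one_add hN]
  exact ((Commute.one_right _).add_right (commute_tauOp hN)).eq.symm

theorem tauOp_pow_apply_eq_zero (v : M) : ∃ m, (tauOp N ^ m) v = 0 := by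
  obtain ⟨m, hm⟩ := hN v
  refine ⟨m, ?_⟩
  have h1 : Commute N (N * geom (-N)) := (Commute.refl N).mul_right (commute_geom_neg hN).symm
  rw [tauOp, mul_assoc, h1.mul_pow, (h1.pow_pow m m).eq, Module.End.mul_apply, hm, map_zero]

theorem isLocLim_sOp :
    IsLocLim (fun n => ∑ i ∈ Finset.range n, R ^ i * (1 - R * N) * sigmaOp N i) (sOp N R) :=
  isLocLim_locLim fun v => by
    obtain ⟨m, hm⟩ := tauOp_pow_apply_eq_zero hN v
    refine ⟨_, Filter.eventually_atTop.mpr ⟨2 * m, fun n hn =>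
      sum_range_eventually_const (fun i hi => ?_) hn⟩⟩
    rw [Module.End.mul_apply, sigmaOp_apply_eq_zero hi hm, map_zero]

variable (hNR : N * R = 1)
include hNR

omit hN in
theorem proj_mul_pow_mul_pow_mul_proj (i j : ℕ) :
    (1 - R * N) * N ^ j * (R ^ i * (1 - R * N)) = if i = j then 1 - R * N else 0 := by
  have h1 : N * (1 - R * N) = 0 := by rw [mul_sub, ← mul_assoc, hNR, one_mul, mul_one, sub_self]
  have h2 : (1 - R * N) * R = 0 := by rw [sub_mul, mul_assoc, hNR, one_mul, mul_one, sub_self]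
  have h3 : (1 - R * N) * (1 - R * N) = 1 - R * N := by
    rw [sub_mul, mul_assoc R, h1, mul_zero, one_mul, sub_zero]
  induction j generalizing i with
  | zero =>
    cases i with
    | zero => simpa using h3
    | succ i =>
      rw [pow_zero, mul_one, pow_succ', mul_assoc R, ← mul_assoc, h2, zero_mul, if_neg (by simp)]
  | succ j ih =>
    cases i with
    | zero =>
      rw [pow_zero, one_mul, pow_succ, ← mul_assoc, mul_assoc _ N, h1, mul_zero, if_neg (by simp)]
    | succ i =>
      have := ih i
      simp only [Nat.add_right_cancel_iff]
      rw [← this, pow_succ, pow_succ' R, ← mul_assoc _ (N ^ j) N, mul_assoc _ N, mul_assoc R,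
        ← mul_assoc N R, hNR, one_mul]

omit hNR in
/-- A vector is determined by the components `(1 - R N) N ^ j v` in the kernel of `N`. -/
theorem eq_zero_of_proj_mul_pow_mul {X : Module.End k M}
    (hX : ∀ j, (1 - R * N) * N ^ j * X = 0) : X = 0 := by
  ext v
  obtain ⟨m, hm⟩ := hN (X v)
  induction m with
  | zero => simpa using hm
  | succ m ih =>
    refine ih ?_
    have h := LinearMap.congr_fun (hX m) v
    rw [pow_succ'] at hm
    simp only [Module.End.mul_apply, LinearMap.sub_apply, Module.End.one_apply,
      LinearMap.zero_apply] at h hm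
    rwa [hm, map_zero, sub_zero] at h

theorem proj_mul_pow_mul_sOp (j : ℕ) :
    (1 - R * N) * N ^ j * sOp N R = (1 - R * N) * sigmaOp N j := by
  refine ((IsLocLim.const _).mul (isLocLim_sOp hN)).unique fun v => ?_
  refine Filter.eventually_atTop.mpr ⟨j + 1, fun n hn => ?_⟩
  refine LinearMap.congr_fun ?_ v
  beta_reduce
  rw [Finset.mul_sum, Finset.sum_eq_single j]
  · rw [← mul_assoc, proj_mul_pow_mul_pow_mul_proj hNR, if_pos rfl]
  · intro i _ hij
    rw [← mul_assoc, proj_mul_pow_mul_pow_mul_proj hNR, if_neg hij, zero_mul]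
  · intro hj
    exact absurd (Finset.mem_range.mpr hn) hj

theorem proj_mul_sOp : (1 - R * N) * sOp N R = (1 - R * N) * (kappaOp (tauOp N) * N) := by
  simpa using! proj_mul_pow_mul_sOp hN hNR 0

theorem proj_mul_mul_sOp :
    (1 - R * N) * N * sOp N R = (1 - R * N) * (1 - kappaOp (tauOp N) * tauOp N) := by
  simpa using! proj_mul_pow_mul_sOp hN hNR 1

theorem sq_mul_sOp : N * N * sOp N R = (1 + N) * sOp N R * tauOp N := by
  rw [← sub_eq_zero]
  refine eq_zero_of_proj_mul_pow_mul (R := R) hN fun j => ?_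
  have h0 := proj_mul_pow_mul_sOp hN hNR j
  have h1 := proj_mul_pow_mul_sOp hN hNR (j + 1)
  have h2 := proj_mul_pow_mul_sOp hN hNR (j + 2)
  have h3 : sigmaOp N (j + 2) = (sigmaOp N (j + 1) + sigmaOp N j) * tauOp N := rfl
  rw [h3] at h2
  rw [pow_succ] at h1
  rw [pow_succ, pow_succ] at h2
  generalize N ^ j = n at *
  linear_combination (norm := noncomm_ring) h2 - h1 * tauOp N - h0 * tauOp N

theorem commute_sOp_tauOp : Commute (sOp N R) (tauOp N) := by
  have h : (1 + N) * (sOp N R * tauOp N) = (1 + N) * (tauOp N * sOp N R) := by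
    rw [← mul_assoc, ← sq_mul_sOp hN hNR, ← mul_assoc, one_add_mul_tauOp hN]
  have h' := congrArg (geom (-N) * ·) h
  simpa only [← mul_assoc, geom_mul_one_add hN, one_mul] using! h'

omit hNR in
/-- An operator on which `τ` acts in the same way from both sides is determined by its two leading
components. -/
theorem eq_zero_of_proj_mul {X : Module.End k M} (h : N * N * X = (1 + N) * X * tauOp N)
    (h0 : (1 - R * N) * X = 0) (h1 : (1 - R * N) * N * X = 0) : X = 0 := by
  refine eq_zero_of_proj_mul_pow_mul (R := R) hN fun j => ?_
  induction j using Nat.strong_induction_on with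
  | _ j ih =>
    match j, ih with
    | 0, _ => simpa using h0
    | 1, _ => simpa using h1
    | j + 2, ih =>
      have e0 := ih j (by omega)
      have e1 := ih (j + 1) (by omega)
      rw [pow_succ] at e1
      rw [pow_succ, pow_succ]
      generalize N ^ j = n at *
      linear_combination (norm := noncomm_ring)
        (1 - R * N) * n * h + e0 * tauOp N + e1 * tauOp N

theorem sOp_mul_sOp : sOp N R * sOp N R = -1 := by
  have hτ := tauOp_pow_apply_eq_zero hN
  have hSτ := (commute_sOp_tauOp hN hNR).eq
  have hκS := (commute_kappaOp hτ (commute_sOp_tauOp hN hNR).symm).eq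
  have hκN := (commute_kappaOp hτ (commute_tauOp hN)).eq
  have hκτ := (commute_kappaOp hτ (Commute.refl _)).eq
  have hτN := (commute_tauOp hN).eq
  have hκ := kappaOp_eq hτ
  have hS := sq_mul_sOp hN hNR
  have h0 := proj_mul_sOp hN hNR
  have h1 := proj_mul_mul_sOp hN hNR
  have hT := one_add_mul_tauOp hN
  rw [← sub_eq_zero]
  refine eq_zero_of_proj_mul (R := R) hN ?_ ?_ ?_
  all_goals
    generalize sOp N R = S at *
    generalize kappaOp (tauOp N) = κ at *
    generalize tauOp N = τ at *
    generalize 1 - R * N = p at *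
  · linear_combination (norm := noncomm_ring) hS * S - (1 + N) * S * hSτ - hT
  · linear_combination (norm := noncomm_ring) h0 * S + p * hκN * S + p * N * hκS + h1 * κ +
      p * hκ + p * κ * hκτ
  · linear_combination (norm := noncomm_ring) h1 * S + h0 * (1 - κ * τ) + p * κ * hSτ -
      p * hκS * τ + p * hκ * N + p * κ * κ * hτN + p * κ * hκN * τ

theorem sOp_mul_add_mul_sOp : sOp N R * N + N * sOp N R = 1 + tauOp N * sOp N R := by
  have hSτ := (commute_sOp_tauOp hN hNR).eq
  have hτN := (commute_tauOp hN).eq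
  have hS := sq_mul_sOp hN hNR
  have h0 := proj_mul_sOp hN hNR
  have h1 := proj_mul_mul_sOp hN hNR
  have hT := one_add_mul_tauOp hN
  rw [← sub_eq_zero]
  refine eq_zero_of_proj_mul (R := R) hN ?_ ?_ ?_
  all_goals
    generalize sOp N R = S at *
    generalize kappaOp (tauOp N) = κ at *
    generalize tauOp N = τ at *
    generalize 1 - R * N = p at *
  · linear_combination (norm := noncomm_ring) hS * N + (1 + N) * S * hτN + N * hS + hT - τ * hS +
      (hτN * N + N * hτN) * S - hτN * S * τ
  · linear_combination (norm := noncomm_ring) h0 * N + h1 + p * hSτ - h0 * τ - p * κ * hT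
  · linear_combination (norm := noncomm_ring) h1 * N + p * hS + p * N * hSτ + h0 * τ - p * κ * hτN

theorem sOp_mul_one_add_pow_three : (sOp N R * (1 + N)) ^ 3 = -1 := by
  have hSτ := (commute_sOp_tauOp hN hNR).eq
  have hY := sOp_mul_add_mul_sOp hN hNR
  have hSS := sOp_mul_sOp hN hNR
  have hT := tauOp_mul_one_add hN
  generalize sOp N R = S at *
  generalize tauOp N = τ at *
  have hU : S * (1 + N) * (S * (1 + N)) = S * (1 + N) - 1 := by
    linear_combination (norm := noncomm_ring) S * hY * (1 + N) - S * hSτ * (1 + N) +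
      hSS * (1 - N * N + τ * (1 + N)) - hT
  rw [pow_succ, pow_two]
  generalize S * (1 + N) = U at *
  linear_combination (norm := noncomm_ring) hU * U + hU

theorem exists_representation_of_locally_nilpotent : ∃ ρ : Representation k SL(2, ℤ) M,
    ρ ModularGroup.S = sOp N R ∧ ρ ModularGroup.T = 1 + N := by
  have hSS := sOp_mul_sOp hN hNR
  let s : (Module.End k M)ˣ := ⟨sOp N R, -sOp N R, by rw [mul_neg, hSS, neg_neg],
    by rw [neg_mul, hSS, neg_neg]⟩
  let t : (Module.End k M)ˣ := ⟨1 + N, geom (-N), one_add_mul_geom hN, geom_mul_one_add hN⟩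
  have hs2 : s ^ 2 = -1 := Units.ext ((pow_two (sOp N R)).trans hSS)
  have hst : (s * t) ^ 3 = s ^ 2 := by
    rw [hs2]
    exact Units.ext (sOp_mul_one_add_pow_three hN hNR)
  obtain ⟨φ, hS, hT⟩ := exists_hom_of_relations (s := s) (t := t)
    (by rw [show 4 = 2 * 2 from rfl, pow_mul, hs2, neg_one_sq]) hst
  refine ⟨(Units.coeHom _).comp φ, ?_, ?_⟩
  · rw [MonoidHom.comp_apply, hS]; rfl
  · rw [MonoidHom.comp_apply, hT]; rfl

end Construction

/-! ### Divisor operators -/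

/-- The operator `e_n ↦ ∑ e_d` over the `d < n` that divide `k * n`. For `k = 1` this is the
divisor matrix minus the identity. -/
noncomputable def divOp (k : ℕ) : Module.End ℂ E :=
  Finsupp.linearCombination ℂ fun n =>
    ∑ d ∈ (Finset.Iio n).filter (fun d : ℕ+ => (d : ℕ) ∣ k * n), Finsupp.single d 1

/-- The operator `e_n ↦ e_{2 n}`. -/
noncomputable def dblOp : Module.End ℂ E := Finsupp.lmapDomain ℂ ℂ fun n => 2 * n

/-- A right inverse of `divOp 1`, with image in the span of the `e_n` for even `n`. It exists as
`divOp 1 * dblOp = 1 + divOp 2` is unitriangular. -/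
noncomputable def rightInv : Module.End ℂ E := dblOp * geom (-divOp 2)

theorem divOp_single (k : ℕ) (n : ℕ+) : divOp k (Finsupp.single n 1) =
    ∑ d ∈ (Finset.Iio n).filter (fun d : ℕ+ => (d : ℕ) ∣ k * n), Finsupp.single d 1 := by
  rw [divOp, Finsupp.linearCombination_single, one_smul]

theorem dblOp_single (n : ℕ+) : dblOp (Finsupp.single n 1) = Finsupp.single (2 * n) 1 := by
  rw [dblOp, Finsupp.lmapDomain_apply, Finsupp.mapDomain_single]

theorem divOp_single_apply (k : ℕ) (n i : ℕ+) :
    divOp k (Finsupp.single n 1) i = if i < n ∧ (i : ℕ) ∣ k * n then 1 else 0 := by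
  classical
  rw [divOp_single, Finsupp.finsetSum_apply]
  simp_rw [Finsupp.single_apply]
  rw [Finset.sum_ite_eq']
  simp

theorem matrixOf_one_add_divOp : matrixOf (1 + divOp 1) = divisorMatrix := by
  classical
  ext i j
  change (Finsupp.single j (1 : ℂ) : E) i + divOp 1 (Finsupp.single j 1) i =
    if (i : ℕ) ∣ j then 1 else 0
  rw [divOp_single_apply, one_mul, Finsupp.single_apply]
  by_cases hij : j = i
  · simp [hij]
  · by_cases hd : (i : ℕ) ∣ j
    · have : i < j := lt_of_le_of_ne (Nat.le_of_dvd j.pos hd) (Ne.symm hij)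
      simp [hij, hd, this]
    · simp [hij, hd]

theorem divOp_mem_stab_intLattice (k : ℕ) : divOp k ∈ stab intLattice :=
  mem_stab_intLattice fun n => by
    rw [divOp_single]
    exact sum_mem fun d _ => single_mem_intLattice d

theorem dblOp_mem_stab_intLattice : dblOp ∈ stab intLattice :=
  mem_stab_intLattice fun n => by
    rw [dblOp_single]
    exact single_mem_intLattice _

theorem divOp_pow_apply_eq_zero (k : ℕ) (v : E) : ∃ m, (divOp k ^ m) v = 0 := by
  obtain ⟨x, hx⟩ := exists_mem_Lev v
  refine ⟨x, ?_⟩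
  induction x generalizing v with
  | zero => simpa using! eq_zero_of_mem_Lev one_pos hx
  | succ x ih =>
    rw [pow_succ, Module.End.mul_apply]
    refine ih _ (map_mem_of_mem_Lev (fun n hn => ?_) hx)
    rw [divOp_single]
    refine Submodule.sum_mem _ fun d hd => single_mem_Lev ?_ 1
    have : (d : ℕ) < n :=
    PNat.coe_lt_coe _ _ |>.mpr (Finset.mem_Iio.mp (Finset.mem_filter.mp hd).1)
    omega

/-- A proper divisor of `n` is at most `n / 2`. -/
theorem divOp_one_mem_Lev {c x : ℕ} {v : E} (hv : v ∈ Lev c x) : divOp 1 v ∈ Lev (2 * c) x := by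
  refine map_mem_of_mem_Lev (fun n hn => ?_) hv
  rw [divOp_single]
  refine Submodule.sum_mem _ fun d hd => single_mem_Lev ?_ 1
  have hlt : (d : ℕ) < n :=
    PNat.coe_lt_coe _ _ |>.mpr (Finset.mem_Iio.mp (Finset.mem_filter.mp hd).1)
  obtain ⟨e, he⟩ := (Finset.mem_filter.mp hd).2
  rw [one_mul] at he
  have he2 : 2 ≤ e := by
    by_contra hlt2
    have : e ≤ 1 := by omega
    have := Nat.mul_le_mul_left (d : ℕ) this
    omega
  calc 2 * c * (d : ℕ) = c * (d * 2) := by ring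
    _ ≤ c * n := by rw [he]; gcongr
    _ ≤ x := hn

theorem divOp_one_mul_dblOp : divOp 1 * dblOp = 1 + divOp 2 := by
  classical
  refine Finsupp.lhom_ext' fun n => LinearMap.ext_ring ?_
  ext i
  change divOp 1 (dblOp (Finsupp.single n 1)) i =
    (Finsupp.single n (1 : ℂ) : E) i + divOp 2 (Finsupp.single n 1) i
  rw [dblOp_single, divOp_single_apply, divOp_single_apply, Finsupp.single_apply, one_mul,
    PNat.mul_coe]
  change (if (i : ℕ) < (2 * n : ℕ+) ∧ (i : ℕ) ∣ 2 * n then (1 : ℂ) else 0) = _ +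
    if (i : ℕ) < n ∧ (i : ℕ) ∣ 2 * n then (1 : ℂ) else 0
  rw [PNat.mul_coe]
  change (if (i : ℕ) < 2 * n ∧ (i : ℕ) ∣ 2 * n then (1 : ℂ) else 0) = _
  have hn := n.pos
  by_cases hni : n = i
  · subst hni
    rw [if_pos ⟨by omega, Dvd.intro_left 2 rfl⟩, if_pos rfl, if_neg (by simp), add_zero]
  · have hni' : (n : ℕ) ≠ i := fun h => hni (PNat.coe_injective h)
    rw [if_neg hni, zero_add]
    refine if_congr ⟨fun h => ⟨?_, h.2⟩, fun h => ⟨by omega, h.2⟩⟩ rfl rfl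
    -- a proper divisor of `2 * n` other than `n` is less than `n`
    obtain ⟨h1, e, he⟩ := h
    have : 2 ≤ e := by
      by_contra hlt
      have := Nat.mul_le_mul_left (i : ℕ) (show e ≤ 1 by omega)
      omega
    have := Nat.mul_le_mul_left (i : ℕ) this
    omega

theorem divOp_one_mul_rightInv : divOp 1 * rightInv = 1 := by
  rw [rightInv, ← mul_assoc, divOp_one_mul_dblOp]
  exact one_add_mul_geom (divOp_pow_apply_eq_zero 2)

theorem rightInv_mem_stab_intLattice : rightInv ∈ stab intLattice :=
  mul_mem dblOp_mem_stab_intLattice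
    (geom_mem_stab (neg_pow_apply_eq_zero (divOp_pow_apply_eq_zero 2))
      (neg_mem (divOp_mem_stab_intLattice 2)))

theorem rightInv_apply_of_odd {m : ℕ+} (hm : Odd (m : ℕ)) (v : E) : rightInv v m = 0 := by
  rw [rightInv, Module.End.mul_apply, dblOp, Finsupp.lmapDomain_apply]
  refine Finsupp.mapDomain_of_notMem_range _ _ ?_
  rintro ⟨n, hn⟩
  have : (m : ℕ) = 2 * n := by rw [← hn]; rfl
  rw [this] at hm
  exact absurd hm (by simp)

/-! ### Norm estimates -/

theorem sum_Ico_inv_cube_le {k : ℕ} (hk : 1 ≤ k) (M : ℕ) (hM : k + 1 ≤ M) :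
    ∑ e ∈ Finset.Ico (k + 1) M, (((e : ℝ) ^ 3)⁻¹) ≤
      (2 * k * (k + 1) : ℝ)⁻¹ - (2 * (M - 1) * M : ℝ)⁻¹ := by
  have hk' : (1 : ℝ) ≤ k := by exact_mod_cast hk
  induction M, hM using Nat.le_induction with
  | base => simp
  | succ M hM ih =>
    have hM' : (2 : ℝ) ≤ M := by exact_mod_cast (show 2 ≤ M by omega)
    rw [Finset.sum_Ico_succ_top hM]
    refine (add_le_add_left ih _).trans ?_
    have e1 : (2 * (M - 1) * M : ℝ)⁻¹ - (2 * M * (M + 1) : ℝ)⁻¹ = (M * ((M : ℝ) ^ 2 - 1))⁻¹ := by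
      have h1 : (M : ℝ) - 1 ≠ 0 := by linarith
      have h2 : (M : ℝ) + 1 ≠ 0 := by linarith
      have h3 : (M : ℝ) ≠ 0 := by linarith
      have h4 : (M : ℝ) ^ 2 - 1 ≠ 0 := by nlinarith
      field_simp
      ring
    have e2 : ((M : ℝ) ^ 3)⁻¹ ≤ (M * ((M : ℝ) ^ 2 - 1))⁻¹ := by
      apply inv_anti₀
      · have : (0 : ℝ) < (M : ℝ) ^ 2 - 1 := by nlinarith
        positivity
      · nlinarith
    push_cast
    rw [add_sub_cancel_right]
    linarith

/-- The complementary divisors `k * n / d` are distinct and exceed `k`, so that the norm is at most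
`k ^ 3 * ∑ e ^ (-3)` over `e > k`. -/
theorem opBound_divOp {k : ℕ} (hk : 1 ≤ k) : OpBound (divOp k) (k ^ 2 / (2 * (k + 1))) :=
  OpBound.of_single fun n => by
    have hk' : (1 : ℝ) ≤ k := by exact_mod_cast hk
    have hkn : 0 < k * (n : ℕ) := Nat.mul_pos hk n.pos
    rw [divOp_single]
    refine (wnorm_sum_le _ _).trans ?_
    simp_rw [wnorm_single, norm_one, one_mul]
    have hdiv : ∀ d ∈ (Finset.Iio n).filter (fun d : ℕ+ => (d : ℕ) ∣ k * n),
        k + 1 ≤ k * (n : ℕ) / d ∧ (d : ℕ) * (k * (n : ℕ) / d) = k * n := fun d hd => by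
      have hlt : (d : ℕ) < n :=
        PNat.coe_lt_coe _ _ |>.mpr (Finset.mem_Iio.mp (Finset.mem_filter.mp hd).1)
      refine ⟨?_, Nat.mul_div_cancel' (Finset.mem_filter.mp hd).2⟩
      obtain ⟨e, he⟩ := (Finset.mem_filter.mp hd).2
      rw [he, Nat.mul_div_cancel_left _ d.pos]
      by_contra hek
      have h1 := Nat.mul_le_mul_left (d : ℕ) (show e ≤ k by omega)
      have h2 := Nat.mul_lt_mul_of_pos_right hlt hk
      rw [mul_comm (n : ℕ)] at h2
      omega
    have hinj : Set.InjOn (fun d : ℕ+ => k * (n : ℕ) / d)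
        ((Finset.Iio n).filter (fun d : ℕ+ => (d : ℕ) ∣ k * n)) := fun d hd d' hd' h => by
      have h1 := (hdiv d hd).2
      have h2 := (hdiv d' hd').2
      rw [← show k * (n : ℕ) / d = k * (n : ℕ) / d' from h] at h2
      replace h2 := h2.trans h1.symm
      refine (PNat.coe_injective (Nat.eq_of_mul_eq_mul_right ?_ h2)).symm
      exact (Nat.succ_pos k).trans_le (hdiv d hd).1
    have hle : ∑ d ∈ (Finset.Iio n).filter (fun d : ℕ+ => (d : ℕ) ∣ k * n), (d : ℝ) ^ 3 ≤
        ∑ e ∈ Finset.Ico (k + 1) (k * n + 1), (k * n : ℝ) ^ 3 * ((e : ℝ) ^ 3)⁻¹ := by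
      calc _ = ∑ d ∈ (Finset.Iio n).filter (fun d : ℕ+ => (d : ℕ) ∣ k * n),
            (k * n : ℝ) ^ 3 * (((k * (n : ℕ) / d : ℕ) : ℝ) ^ 3)⁻¹ := by
            refine Finset.sum_congr rfl fun d hd => ?_
            obtain ⟨h1, h2⟩ := hdiv d hd
            have h3 : (d : ℝ) * ((k * (n : ℕ) / d : ℕ) : ℝ) = k * n := by exact_mod_cast h2
            have h4 : ((k * (n : ℕ) / d : ℕ) : ℝ) ≠ 0 := by
              exact_mod_cast (show k * (n : ℕ) / d ≠ 0 by omega)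
            rw [← h3, mul_pow, mul_inv_cancel_right₀ (pow_ne_zero _ h4)]
        _ = ∑ e ∈ ((Finset.Iio n).filter (fun d : ℕ+ => (d : ℕ) ∣ k * n)).image
              (fun d : ℕ+ => k * (n : ℕ) / d), (k * n : ℝ) ^ 3 * ((e : ℝ) ^ 3)⁻¹ :=
            (Finset.sum_image (f := fun e : ℕ => (k * n : ℝ) ^ 3 * ((e : ℝ) ^ 3)⁻¹) hinj).symm
        _ ≤ _ := by
            refine Finset.sum_le_sum_of_subset_of_nonneg (fun e he => ?_)
              fun _ _ _ => by positivity
            obtain ⟨d, hd, rfl⟩ := Finset.mem_image.mp he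
            exact Finset.mem_Ico.mpr ⟨(hdiv d hd).1, Nat.lt_succ_of_le (Nat.div_le_self _ _)⟩
    refine hle.trans ?_
    rw [← Finset.mul_sum]
    have hkn1 : k + 1 ≤ k * (n : ℕ) + 1 := Nat.succ_le_succ (Nat.le_mul_of_pos_right k n.pos)
    have hsum : ∑ e ∈ Finset.Ico (k + 1) (k * (n : ℕ) + 1), (((e : ℝ) ^ 3)⁻¹) ≤
        (2 * k * (k + 1) : ℝ)⁻¹ := by
      refine (sum_Ico_inv_cube_le hk _ hkn1).trans (sub_le_self _ ?_)
      push_cast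
      rw [add_sub_cancel_right]
      positivity
    calc (k * n : ℝ) ^ 3 * ∑ e ∈ Finset.Ico (k + 1) (k * (n : ℕ) + 1), (((e : ℝ) ^ 3)⁻¹)
        ≤ (k * n : ℝ) ^ 3 * (2 * k * (k + 1) : ℝ)⁻¹ := by gcongr
      _ = k ^ 2 / (2 * (k + 1)) * (n : ℝ) ^ 3 := by
        field_simp

theorem opBound_divOp_one : OpBound (divOp 1) (1 / 4) := by
  have := opBound_divOp le_rfl
  norm_num at this
  exact this

theorem opBound_rightInv : OpBound rightInv 24 := by
  have hdbl : OpBound dblOp 8 := OpBound.of_single fun n => by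
    rw [dblOp_single, wnorm_single, norm_one, one_mul]
    have : ((2 * n : ℕ+) : ℝ) = 2 * n := by push_cast; rfl
    rw [this, mul_pow]
    norm_num
  have h2 : OpBound (divOp 2) (2 / 3) := by
    have := opBound_divOp one_le_two
    norm_num at this
    exact this
  have hg := OpBound.geom (neg_pow_apply_eq_zero (divOp_pow_apply_eq_zero 2)) h2.neg
    (by norm_num) (by norm_num)
  exact (hdbl.mul hg (by norm_num)).mono (by norm_num)

theorem opBound_tauOp : OpBound (tauOp (divOp 1)) (1 / 12) := by
  have hg := OpBound.geom (neg_pow_apply_eq_zero (divOp_pow_apply_eq_zero 1))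
    opBound_divOp_one.neg (by norm_num) (by norm_num)
  exact ((opBound_divOp_one.mul opBound_divOp_one (by norm_num)).mul hg (by norm_num)).mono
    (by norm_num)

theorem opBound_kappaOp : OpBound (kappaOp (tauOp (divOp 1))) 2 :=
  OpBound.of_isLocLim (isLocLim_kappaSeq (tauOp_pow_apply_eq_zero (divOp_pow_apply_eq_zero 1)))
    fun n => by
      induction n with
      | zero => exact OpBound.one.neg.mono (by norm_num)
      | succ n ih =>
        exact (OpBound.one.neg.add ((ih.mul ih (by norm_num)).mul opBound_tauOp
          (by norm_num))).mono (by norm_num)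

theorem opBound_sigmaOp (n : ℕ) : OpBound (sigmaOp (divOp 1) n) 2 := by
  suffices h : OpBound (sigmaOp (divOp 1) n) 2 ∧ OpBound (sigmaOp (divOp 1) (n + 1)) 2 from h.1
  induction n with
  | zero =>
    exact ⟨(opBound_kappaOp.mul opBound_divOp_one (by norm_num)).mono (by norm_num),
      (OpBound.one.sub (opBound_kappaOp.mul opBound_tauOp (by norm_num))).mono (by norm_num)⟩
  | succ n ih =>
    exact ⟨ih.2, ((ih.2.add ih.1).mul opBound_tauOp (by norm_num)).mono (by norm_num)⟩

/-- The operator representing `S`. -/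
noncomputable def opS : Module.End ℂ E := sOp (divOp 1) rightInv

theorem geom_mem_Lev {c x : ℕ} {v : E} (hv : v ∈ Lev c x) : geom (-divOp 1) v ∈ Lev c x := by
  refine geom_mem_stab (W := (Lev c x).toAddSubgroup)
    (neg_pow_apply_eq_zero (divOp_pow_apply_eq_zero 1)) (neg_mem fun w hw => ?_) v hv
  refine mem_Lev.mpr fun j hj => ?_
  have := mem_Lev.mp (divOp_one_mem_Lev hw) j hj
  refine le_trans ?_ this
  gcongr
  omega

theorem divOp_one_pow_mem_Lev {c x : ℕ} {v : E} (hv : v ∈ Lev c x) (n : ℕ) :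
    (divOp 1 ^ n) v ∈ Lev (2 ^ n * c) x := by
  induction n with
  | zero => simpa using! hv
  | succ n ih =>
    rw [pow_succ', pow_succ', mul_assoc]
    exact divOp_one_mem_Lev ih

theorem tauOp_pow_mem_Lev {c x : ℕ} {v : E} (hv : v ∈ Lev c x) (n : ℕ) :
    (tauOp (divOp 1) ^ n) v ∈ Lev (4 ^ n * c) x := by
  induction n with
  | zero => simpa using! hv
  | succ n ih =>
    rw [pow_succ', pow_succ', mul_assoc, show 4 * (4 ^ n * c) = 2 * (2 * (4 ^ n * c)) by ring]
    exact divOp_one_mem_Lev (divOp_one_mem_Lev (geom_mem_Lev ih))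

theorem tauOp_mem_stab {W : AddSubgroup E} (hW : divOp 1 ∈ stab W) : tauOp (divOp 1) ∈ stab W :=
  mul_mem (mul_mem hW hW)
    (geom_mem_stab (neg_pow_apply_eq_zero (divOp_pow_apply_eq_zero 1)) (neg_mem hW))

theorem sigmaOp_mem_stab {W : AddSubgroup E} (hW : divOp 1 ∈ stab W) (n : ℕ) :
    sigmaOp (divOp 1) n ∈ stab W := by
  have hτ := tauOp_mem_stab hW
  have hκ := kappaOp_mem_stab (tauOp_pow_apply_eq_zero (divOp_pow_apply_eq_zero 1)) hτ
  suffices h : sigmaOp (divOp 1) n ∈ stab W ∧ sigmaOp (divOp 1) (n + 1) ∈ stab W from h.1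
  induction n with
  | zero => exact ⟨mul_mem hκ hW, sub_mem (one_mem _) (mul_mem hκ hτ)⟩
  | succ n ih => exact ⟨ih.2, mul_mem (add_mem ih.2 ih.1) hτ⟩

theorem isLocLim_opS : IsLocLim (fun n => ∑ i ∈ Finset.range n,
    rightInv ^ i * (1 - rightInv * divOp 1) * sigmaOp (divOp 1) i) opS :=
  isLocLim_sOp (divOp_pow_apply_eq_zero 1)

theorem opS_mem_stab_intLattice : opS ∈ stab intLattice :=
  isLocLim_opS.mem_stab fun _ => sum_mem fun i _ =>
    mul_mem (mul_mem (pow_mem rightInv_mem_stab_intLattice i) (sub_mem (one_mem _)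
      (mul_mem rightInv_mem_stab_intLattice (divOp_mem_stab_intLattice 1))))
      (sigmaOp_mem_stab (divOp_mem_stab_intLattice 1) i)

/-- Only the terms with `4 ^ (i / 2) ≤ n` of the series defining `opS` contribute to the image of
`e_n`, and the norms of the terms grow at most like `24 ^ i`. -/
theorem wnorm_opS_single_le (n : ℕ+) :
    wnorm (opS (Finsupp.single n 1)) ≤ 8064 * (n : ℝ) ^ (8 : ℝ) := by
  set L := Nat.log 4 n with hL
  have hLn : 4 ^ L ≤ (n : ℕ) := Nat.pow_log_le_self 4 n.pos.ne'
  have hτ : (tauOp (divOp 1) ^ (L + 1)) (Finsupp.single n 1) = 0 := by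
    refine eq_zero_of_mem_Lev (c := 4 ^ (L + 1) * 1) (x := n) ?_
      (tauOp_pow_mem_Lev (single_mem_Lev (by simp) 1) _)
    rw [mul_one]
    exact Nat.lt_pow_succ_log_self (by norm_num) _
  have hS : opS (Finsupp.single n 1) = (∑ i ∈ Finset.range (2 * (L + 1)),
      rightInv ^ i * (1 - rightInv * divOp 1) * sigmaOp (divOp 1) i) (Finsupp.single n 1) := by
    obtain ⟨k, hk, hk'⟩ := ((isLocLim_opS (Finsupp.single n 1)).and
      (Filter.eventually_ge_atTop (2 * (L + 1)))).exists
    rw [← hk]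
    refine sum_range_eventually_const (fun i hi => ?_) hk'
    rw [Module.End.mul_apply, sigmaOp_apply_eq_zero hi hτ, map_zero]
  have hπ : OpBound (1 - rightInv * divOp 1) 7 :=
    (OpBound.one.sub (opBound_rightInv.mul opBound_divOp_one (by norm_num))).mono (by norm_num)
  have hb := OpBound.sum (s := Finset.range (2 * (L + 1))) (fun i _ =>
    ((opBound_rightInv.pow (by norm_num) i).mul hπ (by positivity)).mul (opBound_sigmaOp i)
      (by positivity)) (Finsupp.single n 1)
  rw [hS]
  refine hb.trans ?_
  rw [wnorm_single, norm_one, one_mul, ← Finset.sum_mul, ← Finset.sum_mul]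
  have h1 : ∑ i ∈ Finset.range (2 * (L + 1)), (24 : ℝ) ^ i ≤ 576 * (n : ℝ) ^ 5 := by
    have hn : (4 : ℝ) ^ L ≤ n := by exact_mod_cast hLn
    calc ∑ i ∈ Finset.range (2 * (L + 1)), (24 : ℝ) ^ i ≤ 24 ^ (2 * (L + 1)) := by
          rw [geom_sum_eq (by norm_num)]
          rw [div_le_iff₀ (by norm_num)]
          nlinarith [pow_pos (show (0 : ℝ) < 24 by norm_num) (2 * (L + 1))]
      _ = 576 * 576 ^ L := by rw [pow_mul, pow_succ']; norm_num
      _ ≤ 576 * (4 ^ 5) ^ L := by gcongr; norm_num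
      _ = 576 * (4 ^ L) ^ 5 := by rw [← pow_mul, ← pow_mul, mul_comm 5]
      _ ≤ 576 * (n : ℝ) ^ 5 := by gcongr
  rw [show (8 : ℝ) = (8 : ℕ) by norm_num, Real.rpow_natCast]
  calc (∑ i ∈ Finset.range (2 * (L + 1)), (24 : ℝ) ^ i) * 7 * 2 * (n : ℝ) ^ 3
      ≤ 576 * (n : ℝ) ^ 5 * 7 * 2 * (n : ℝ) ^ 3 := by gcongr
    _ = 8064 * (n : ℝ) ^ 8 := by ring

theorem opS_mem_DR0 : opS ∈ DR0 :=
  polyBounded_of_wnorm_le opS_mem_stab_intLattice (by norm_num) (by norm_num) wnorm_opS_single_le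

theorem divOp_one_mem_DR0 : divOp 1 ∈ DR0 :=
  polyBounded_of_wnorm_le (divOp_mem_stab_intLattice 1) (C := 1 / 4) (c := 3) (by norm_num)
    (by norm_num) fun n => by
      have := opBound_divOp_one (Finsupp.single n 1)
      rw [wnorm_single, norm_one, one_mul] at this
      rwa [show (3 : ℝ) = (3 : ℕ) by norm_num, Real.rpow_natCast]

/-! ### The representation and its filtration -/

/-- The vectors `v` all of whose iterates under `divOp 1` have vanishing `m`-th coordinate. For odd
`m`, the functionals `v ↦ (divOp 1 ^ n v) m` are the coordinates with respect to a Jordan basis. -/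
noncomputable def coordKer (m : ℕ+) : Submodule ℂ E where
  carrier := {v | ∀ n, (divOp 1 ^ n) v m = 0}
  add_mem' hv hw n := by rw [map_add, Finsupp.add_apply, hv n, hw n, add_zero]
  zero_mem' n := by rw [map_zero, Finsupp.zero_apply]
  smul_mem' c v hv n := by rw [map_smul, Finsupp.smul_apply, hv n, smul_zero]

/-- The two leading coordinates of a vector along the Jordan chain that belongs to the odd
number `m`. -/
noncomputable def lead (m : ℕ+) : E →ₗ[ℂ] (Fin 2 → ℂ) :=
  LinearMap.pi ![Finsupp.lapply m, Finsupp.lapply m ∘ₗ divOp 1]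

/-- The `n`-th step of the filtration. The steps are indexed by the pairs `(i, m)` with `m` odd in
the order of `2 ^ i * m`, and the index `(i, m)` stands for the leading coordinates of `τ ^ i v` in
the Jordan chain that belongs to `m`. -/
noncomputable def filt (n : ℕ) : Submodule ℂ E where
  carrier := {v | ∀ (i : ℕ) (m : ℕ+), Odd (m : ℕ) → n < 2 ^ i * m →
    (tauOp (divOp 1) ^ i) v ∈ coordKer m}
  add_mem' hv hw i m hm h := by rw [map_add]; exact add_mem (hv i m hm h) (hw i m hm h)
  zero_mem' i m _ _ := by rw [map_zero]; exact zero_mem _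
  smul_mem' c v hv i m hm h := by
    rw [map_smul]; exact Submodule.smul_mem _ _ (hv i m hm h)

theorem lead_zero (m : ℕ+) (v : E) : lead m v 0 = v m := rfl

theorem lead_one (m : ℕ+) (v : E) : lead m v 1 = divOp 1 v m := rfl

theorem divOp_mem_stab_coordKer (m : ℕ+) : divOp 1 ∈ stab (coordKer m).toAddSubgroup :=
  fun v hv n => by
    rw [← Module.End.mul_apply, ← pow_succ]
    exact hv (n + 1)

theorem apply_eq_zero_of_mem_coordKer {m : ℕ+} {v : E} (hv : v ∈ coordKer m) : v m = 0 := hv 0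

/-- The right action of `S` on the coordinates of a Jordan chain is given by `sigmaOp`. -/
theorem divOp_pow_opS_apply {m : ℕ+} (hm : Odd (m : ℕ)) (n : ℕ) (v : E) :
    (divOp 1 ^ n) (opS v) m = sigmaOp (divOp 1) n v m := by
  have h := LinearMap.congr_fun (proj_mul_pow_mul_sOp (divOp_pow_apply_eq_zero 1)
    divOp_one_mul_rightInv n) v
  have hπ : ∀ w : E, (1 - rightInv * divOp 1) w m = w m := fun w => by
    change w m - rightInv (divOp 1 w) m = w m
    rw [rightInv_apply_of_odd hm, sub_zero]
  have h' := congrArg (fun w : E => w m) h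
  simp only [Module.End.mul_apply] at h'
  rw [hπ, hπ] at h'
  exact h'

theorem opS_mem_stab_coordKer {m : ℕ+} (hm : Odd (m : ℕ)) :
    opS ∈ stab (coordKer m).toAddSubgroup := fun v hv n => by
  rw [divOp_pow_opS_apply hm]
  exact apply_eq_zero_of_mem_coordKer (sigmaOp_mem_stab (divOp_mem_stab_coordKer m) n v hv)

/-- A vector in the kernel of `divOp 1` is determined by its odd coordinates. -/
theorem eq_zero_of_divOp_one_eq_zero {v : E} (hv : divOp 1 v = 0)
    (h : ∀ m : ℕ+, Odd (m : ℕ) → v m = 0) : v = 0 := by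
  have hinj : Function.Injective fun n : ℕ+ => 2 * n := mul_right_injective 2
  have hsupp : (v.support : Set ℕ+) ⊆ Set.range fun n : ℕ+ => 2 * n := fun j hj => by
    rcases Nat.even_or_odd' (j : ℕ) with ⟨n, hn | hn⟩
    · have hj0 := j.pos
      refine ⟨⟨n, by omega⟩, PNat.coe_injective ?_⟩
      rw [hn]; rfl
    · exact absurd (h j ⟨n, hn⟩) (by simpa using hj)
  have hu := Finsupp.mapDomain_comapDomain _ hinj v hsupp
  set u := Finsupp.comapDomain (fun n : ℕ+ => 2 * n) v hinj.injOn
  have hu' : dblOp u = v := hu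
  have h1 : (1 + divOp 2) u = 0 := by
    rw [← divOp_one_mul_dblOp, Module.End.mul_apply, hu', hv]
  have h2 : u = 0 := by
    have := LinearMap.congr_fun (geom_mul_one_add (divOp_pow_apply_eq_zero 2)) u
    rw [Module.End.mul_apply, h1, map_zero] at this
    exact this.symm
  rw [← hu', h2, map_zero]

theorem eq_zero_of_forall_mem_coordKer {v : E} (h : ∀ m : ℕ+, Odd (m : ℕ) → v ∈ coordKer m) :
    v = 0 := by
  obtain ⟨n, hn⟩ := divOp_pow_apply_eq_zero 1 v
  induction n with
  | zero => exact hn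
  | succ n ih =>
    refine ih (eq_zero_of_divOp_one_eq_zero ?_ fun m hm => h m hm n)
    rwa [pow_succ'] at hn

theorem filt_zero : filt 0 = ⊥ := by
  rw [eq_bot_iff]
  intro v hv
  exact eq_zero_of_forall_mem_coordKer fun m hm => hv 0 m hm (by simp)

theorem filt_mono : Monotone filt := fun _ _ h _ hv i m hm hlt => hv i m hm (h.trans_lt hlt)

theorem mem_filt_of_mem_Lev {n : ℕ} {v : E} (hv : v ∈ Lev 1 n) : v ∈ filt n := by
  intro i m _ hlt k
  by_contra hne
  have h := mem_Lev.mp (divOp_one_pow_mem_Lev (tauOp_pow_mem_Lev hv i) k) m hne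
  have h1 : 2 ^ i * (m : ℕ) ≤ 2 ^ k * (4 ^ i * 1) * m := by
    gcongr
    calc 2 ^ i ≤ 4 ^ i := by gcongr; norm_num
      _ ≤ 2 ^ k * (4 ^ i * 1) := by rw [mul_one]; exact Nat.le_mul_of_pos_left _ (by positivity)
  omega

theorem commute_opS_tauOp : Commute opS (tauOp (divOp 1)) :=
  commute_sOp_tauOp (divOp_pow_apply_eq_zero 1) divOp_one_mul_rightInv

theorem one_add_mul_tauOp_apply (v : E) :
    divOp 1 (divOp 1 v) = tauOp (divOp 1) v + divOp 1 (tauOp (divOp 1) v) :=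
  (LinearMap.congr_fun (one_add_mul_tauOp (divOp_pow_apply_eq_zero 1)) v).symm

section Rep

variable {ρ : Representation ℂ SL(2, ℤ) E} (hS : ρ ModularGroup.S = opS)
  (hT : ρ ModularGroup.T = 1 + divOp 1)
include hS hT

theorem rep_mem_of_mem {R : Subring (Module.End ℂ E)} (h1 : opS ∈ R) (h2 : divOp 1 ∈ R)
    (Y : SL(2, ℤ)) : ρ Y ∈ R := by
  induction Y using induction_S_T with
  | one => rw [map_one]; exact one_mem R
  | mul X Y hX hY => rw [map_mul]; exact mul_mem hX hY
  | hS => rw [hS]; exact h1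
  | hT => rw [hT]; exact add_mem (one_mem R) h2

theorem commute_rep_tauOp (Y : SL(2, ℤ)) : Commute (ρ Y) (tauOp (divOp 1)) := by
  induction Y using induction_S_T with
  | one => rw [map_one]; exact Commute.one_left _
  | mul X Y hX hY => rw [map_mul]; exact hX.mul_left hY
  | hS => rw [hS]; exact commute_opS_tauOp
  | hT =>
    rw [hT]
    exact (Commute.one_left _).add_left (commute_tauOp (divOp_pow_apply_eq_zero 1)).symm

theorem tauOp_pow_rep_apply (Y : SL(2, ℤ)) (i : ℕ) (v : E) :
    (tauOp (divOp 1) ^ i) (ρ Y v) = ρ Y ((tauOp (divOp 1) ^ i) v) :=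
  (LinearMap.congr_fun ((commute_rep_tauOp hS hT Y).pow_right i).eq v).symm

theorem rep_apply_mem_coordKer (Y : SL(2, ℤ)) {m : ℕ+} (hm : Odd (m : ℕ)) {v : E}
    (hv : v ∈ coordKer m) : ρ Y v ∈ coordKer m :=
  rep_mem_of_mem hS hT (opS_mem_stab_coordKer hm) (divOp_mem_stab_coordKer m) Y v hv

theorem rep_apply_mem_filt (Y : SL(2, ℤ)) {n : ℕ} {v : E} (hv : v ∈ filt n) :
    ρ Y v ∈ filt n := fun i m hm h => by
  rw [tauOp_pow_rep_apply hS hT]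
  exact rep_apply_mem_coordKer hS hT Y hm (hv i m hm h)

/-- Modulo `τ`, the leading coordinates transform under the standard representation. -/
theorem lead_rep_apply (Y : SL(2, ℤ)) {m : ℕ+} (hm : Odd (m : ℕ)) {v : E}
    (hv : tauOp (divOp 1) v ∈ coordKer m) : lead m (ρ Y v) = standardRep Y (lead m v) := by
  induction Y using induction_S_T generalizing v with
  | one => rw [map_one, map_one]; rfl
  | mul X Y hX hY =>
    have h := tauOp_pow_rep_apply hS hT Y 1 v
    rw [pow_one] at h
    rw [map_mul, map_mul, Module.End.mul_apply, Module.End.mul_apply, ← hY hv, hX]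
    rw [h]
    exact rep_apply_mem_coordKer hS hT Y hm hv
  | hS =>
    have hN := divOp_mem_stab_coordKer m
    have hτ := tauOp_pow_apply_eq_zero (divOp_pow_apply_eq_zero 1)
    have hκ := kappaOp_mem_stab hτ (tauOp_mem_stab hN)
    have e0 := divOp_pow_opS_apply hm 0 v
    have e1 := divOp_pow_opS_apply hm 1 v
    have k0 : sigmaOp (divOp 1) 0 v m = - divOp 1 v m := by
      have h1 := LinearMap.congr_fun (kappaOp_eq hτ) (divOp 1 v)
      have h2 : tauOp (divOp 1) (divOp 1 v) ∈ coordKer m := by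
        have := LinearMap.congr_fun (commute_tauOp (divOp_pow_apply_eq_zero 1)).eq v
        rw [Module.End.mul_apply, Module.End.mul_apply] at this
        rw [this]
        exact hN _ hv
      have h3 := apply_eq_zero_of_mem_coordKer (hκ _ (hκ _ h2))
      change kappaOp (tauOp (divOp 1)) (divOp 1 v) m = _
      rw [h1]
      change - divOp 1 v m + kappaOp (tauOp (divOp 1)) (kappaOp (tauOp (divOp 1))
        (tauOp (divOp 1) (divOp 1 v))) m = _
      rw [h3, add_zero]
    have k1 : sigmaOp (divOp 1) 1 v m = v m := by
      change v m - kappaOp (tauOp (divOp 1)) (tauOp (divOp 1) v) m = v m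
      rw [apply_eq_zero_of_mem_coordKer (hκ _ hv), sub_zero]
    rw [hS]
    ext j
    fin_cases j
    · change opS v m = _
      rw [pow_zero, Module.End.one_apply, k0] at e0
      rw [e0]
      simp [standardRep, ModularGroup.coe_S, Matrix.mulVec, dotProduct, Fin.sum_univ_two,
        lead_one]
    · change divOp 1 (opS v) m = _
      rw [pow_one, k1] at e1
      rw [e1]
      simp [standardRep, ModularGroup.coe_S, Matrix.mulVec, dotProduct, Fin.sum_univ_two,
        lead_zero]
  | hT =>
    have hNN : divOp 1 (divOp 1 v) m = 0 := by
      rw [one_add_mul_tauOp_apply]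
      exact apply_eq_zero_of_mem_coordKer (add_mem hv (divOp_mem_stab_coordKer m _ hv))
    rw [hT]
    ext j
    fin_cases j
    · change v m + divOp 1 v m = _
      simp [standardRep, ModularGroup.coe_T, Matrix.mulVec, dotProduct, Fin.sum_univ_two,
        lead_one, lead_zero]
    · change divOp 1 (v + divOp 1 v) m = _
      rw [map_add, Finsupp.add_apply, hNN, add_zero]
      simp [standardRep, ModularGroup.coe_T, Matrix.mulVec, dotProduct, Fin.sum_univ_two,
        lead_one]

end Rep

theorem two_pow_mul_odd_inj {i i' m m' : ℕ} (hm : Odd m) (hm' : Odd m')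
    (h : 2 ^ i * m = 2 ^ i' * m') : i = i' ∧ m = m' := by
  wlog hle : i ≤ i' generalizing i i' m m'
  · obtain ⟨h1, h2⟩ := this hm' hm h.symm (by omega)
    exact ⟨h1.symm, h2.symm⟩
  obtain ⟨d, rfl⟩ := Nat.exists_eq_add_of_le hle
  rw [pow_add, mul_assoc] at h
  have h1 := Nat.eq_of_mul_eq_mul_left (by positivity) h
  cases d with
  | zero => simpa using h1
  | succ d =>
    rw [pow_succ', mul_assoc] at h1
    rw [h1] at hm
    exact absurd hm (by simp)

section Step

variable {n i : ℕ} {m : ℕ+} (hm : Odd (m : ℕ)) (hn : n + 1 = 2 ^ i * m)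
include hm hn

theorem tauOp_tauOp_pow_mem_coordKer {v : E} (hv : v ∈ filt (n + 1)) :
    tauOp (divOp 1) ((tauOp (divOp 1) ^ i) v) ∈ coordKer m := by
  rw [← Module.End.mul_apply, ← pow_succ']
  refine hv (i + 1) m hm ?_
  have := m.pos
  rw [hn, pow_succ]
  have : 0 < 2 ^ i * (m : ℕ) := by positivity
  linarith

theorem mem_filt_iff_lead_eq_zero {v : E} (hv : v ∈ filt (n + 1)) :
    v ∈ filt n ↔ lead m ((tauOp (divOp 1) ^ i) v) = 0 := by
  constructor
  · intro h
    have h' := h i m hm (by omega)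
    ext j
    fin_cases j
    · exact h' 0
    · exact h' 1
  · intro h i' m' hm' hlt
    rcases (Nat.succ_le_of_lt hlt).lt_or_eq with hlt' | heq
    · exact hv i' m' hm' hlt'
    · obtain ⟨rfl, hmm⟩ := two_pow_mul_odd_inj hm hm' (hn.symm.trans heq)
      obtain rfl := PNat.coe_injective hmm
      have hτ := tauOp_tauOp_pow_mem_coordKer hm hn hv
      intro k
      match k with
      | 0 => exact congrFun h 0
      | 1 => exact congrFun h 1
      | k + 2 =>
        have hmem : divOp 1 (divOp 1 ((tauOp (divOp 1) ^ i) v)) ∈ coordKer m := by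
          rw [one_add_mul_tauOp_apply]
          exact add_mem hτ (divOp_mem_stab_coordKer m _ hτ)
        rw [pow_succ, pow_succ]
        exact hmem k

/-- Leading coordinates `(a, b)` are attained at `(1 + N) ^ i R ^ (2 i) (a x + b R x)`, where `N` is
`divOp 1`, `R` is `rightInv` and `x = (1 - R N) e_m` is a basis vector of the kernel of `N`. -/
theorem exists_lead_eq (w : Fin 2 → ℂ) :
    ∃ v ∈ filt (n + 1), lead m ((tauOp (divOp 1) ^ i) v) = w := by
  have hN := divOp_pow_apply_eq_zero 1
  have hNR : ∀ v, divOp 1 (rightInv v) = v := LinearMap.congr_fun divOp_one_mul_rightInv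
  set N := divOp 1 with hNdef
  set x : E := Finsupp.single m 1 - rightInv (N (Finsupp.single m 1)) with hx
  have hNx : N x = 0 := by rw [hx, map_sub, hNR, sub_self]
  have hxm : x m = 1 := by
    rw [hx, Finsupp.sub_apply, rightInv_apply_of_odd hm, Finsupp.single_eq_same, sub_zero]
  set u : E := w 0 • x + w 1 • rightInv x with hu
  have hNu : N u = w 1 • x := by
    rw [hu, map_add, map_smul, map_smul, hNx, hNR, smul_zero, zero_add]
  have hτu : tauOp N u = 0 := by
    have h := LinearMap.congr_fun (tauOp_mul_one_add hN) (geom (-N) u)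
    have h' := LinearMap.congr_fun (one_add_mul_geom hN) u
    have hc := LinearMap.congr_fun (commute_geom_neg hN).eq
    simp only [Module.End.mul_apply] at h h' hc
    rw [h', Module.End.one_apply] at h
    rw [h, ← hc, ← hc, hNu, map_smul, hNx, smul_zero, map_zero]
  set v : E := ((1 + N) ^ i) ((rightInv ^ (2 * i)) u) with hv
  have hτv : (tauOp N ^ i) v = u := by
    have hc : Commute (tauOp N) (1 + N) := (Commute.one_right _).add_right (commute_tauOp hN)
    rw [hv, ← Module.End.mul_apply, ← hc.mul_pow, tauOp_mul_one_add hN, ← pow_two, ← pow_mul]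
    have : ∀ k (y : E), (N ^ k) ((rightInv ^ k) y) = y := fun k => by
      induction k with
      | zero => exact fun _ => rfl
      | succ k ih =>
        intro y
        rw [pow_succ, pow_succ', Module.End.mul_apply, Module.End.mul_apply, hNR, ih]
    exact this _ u
  refine ⟨v, fun i' m' hm' hlt => ?_, ?_⟩
  · by_cases hmm : m' = m
    · subst hmm
      have hi : i < i' := by
        rw [hn] at hlt
        exact (Nat.pow_lt_pow_iff_right (by norm_num)).mp (Nat.lt_of_mul_lt_mul_right hlt)
      obtain ⟨d, rfl⟩ := Nat.exists_eq_add_of_lt hi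
      rw [show i + d + 1 = (d + 1) + i by ring, pow_add, Module.End.mul_apply, hτv, pow_succ,
        Module.End.mul_apply, hτu, map_zero]
      exact zero_mem _
    · have hNs := divOp_mem_stab_coordKer m'
      have hxmem : x ∈ coordKer m' := fun k => by
        cases k with
        | zero =>
          change x m' = 0
          rw [hx, Finsupp.sub_apply, rightInv_apply_of_odd hm',
            Finsupp.single_eq_of_ne hmm, sub_zero]
        | succ k => rw [pow_succ, Module.End.mul_apply, ← hNdef, hNx, map_zero]; rfl
      have hR : rightInv ∈ stab (coordKer m').toAddSubgroup := fun y hy k => by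
        cases k with
        | zero => exact rightInv_apply_of_odd hm' y
        | succ k => rw [pow_succ, Module.End.mul_apply, hNR]; exact hy k
      have humem : u ∈ coordKer m' :=
        add_mem (Submodule.smul_mem _ _ hxmem) (Submodule.smul_mem _ _ (hR _ hxmem))
      exact pow_mem (tauOp_mem_stab hNs) i' _
        (pow_mem (add_mem (one_mem _) hNs) i _ (pow_mem hR _ _ humem))
  · rw [hτv]
    ext j
    fin_cases j
    · change u m = w 0
      simp [hu, hxm, rightInv_apply_of_odd hm]
    · change N u m = w 1
      simp [hNu, hxm]

end Step

theorem exists_eq_two_pow_mul_odd (n : ℕ) :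
    ∃ (i : ℕ) (m : ℕ+), Odd (m : ℕ) ∧ n + 1 = 2 ^ i * m := by
  obtain ⟨i, m, hm, h⟩ := Nat.exists_eq_two_pow_mul_odd (n := n + 1) (by omega)
  exact ⟨i, ⟨m, hm.pos⟩, hm, h⟩

theorem filt_strictMono : StrictMono filt := by
  refine strictMono_nat_of_lt_succ fun n => lt_of_le_of_ne (filt_mono n.le_succ) fun heq => ?_
  obtain ⟨i, m, hm, hn⟩ := exists_eq_two_pow_mul_odd n
  obtain ⟨v, hv, hlead⟩ := exists_lead_eq hm hn 1
  rw [(mem_filt_iff_lead_eq_zero hm hn hv).mp (heq ▸ hv)] at hlead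
  exact zero_ne_one (congrFun hlead 0)

theorem nonempty_equiv_standardRep {ρ : Representation ℂ SL(2, ℤ) E}
    (hS : ρ ModularGroup.S = opS) (hT : ρ ModularGroup.T = 1 + divOp 1)
    (F : ℕ → Subrepresentation ρ) (hF : ∀ n, (F n).toSubmodule = filt n) (n : ℕ) :
    Nonempty (Representation.Equiv (subquotient (F n) (F (n + 1))) standardRep) := by
  obtain ⟨i, m, hm, hn⟩ := exists_eq_two_pow_mul_odd n
  let f : (F (n + 1)).toSubmodule →ₗ[ℂ] (Fin 2 → ℂ) :=
    (lead m ∘ₗ (tauOp (divOp 1) ^ i)).domRestrict _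
  have hmem : ∀ v : (F (n + 1)).toSubmodule, (v : E) ∈ filt (n + 1) := fun v => hF (n + 1) ▸ v.2
  have hker : (F n).toSubmodule.submoduleOf (F (n + 1)).toSubmodule = LinearMap.ker f := by
    ext v
    change (v : E) ∈ (F n).toSubmodule ↔ _
    rw [LinearMap.mem_ker, hF]
    exact mem_filt_iff_lead_eq_zero hm hn (hmem v)
  have hsurj : Function.Surjective f := fun w => by
    obtain ⟨v, hv, h⟩ := exists_lead_eq hm hn w
    exact ⟨⟨v, hF (n + 1) ▸ hv⟩, h⟩
  refine ⟨Representation.Equiv.mk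
    ((Submodule.quotEquivOfEq _ _ hker).trans (f.quotKerEquivOfSurjective hsurj)) fun g => ?_⟩
  refine Submodule.linearMap_qext _ (LinearMap.ext fun v => ?_)
  change lead m ((tauOp (divOp 1) ^ i) (ρ g v)) =
    standardRep g (lead m ((tauOp (divOp 1) ^ i) v))
  rw [tauOp_pow_rep_apply hS hT]
  exact lead_rep_apply hS hT g hm (tauOp_tauOp_pow_mem_coordKer hm hn (hmem v))

/-! ### The action on Dirichlet series -/

theorem rightAct_mem_DS {A : Module.End ℂ E} (hA : A ∈ DR0) {f : ℕ+ → ℂ} (hf : f ∈ DS) :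
    rightAct f A ∈ DS := by
  obtain ⟨C, hC, c, hc, h1, h2⟩ := hA
  obtain ⟨K, hK, κ, hκ, h3⟩ := hf
  refine ⟨C * (C * (K * C ^ κ)), by positivity, c + (c + c * κ), by positivity, fun n => ?_⟩
  have hn : (0 : ℝ) < n := by exact_mod_cast n.pos
  have hsupp : ∀ k ∈ (A (Finsupp.single n 1)).support, (k : ℝ) ≤ C * (n : ℝ) ^ c := fun k hk =>
    not_lt.mp fun hlt => Finsupp.mem_support_iff.mp hk (h1 k n hlt)
  refine (norm_sum_le (A (Finsupp.single n 1)).support (fun m => matrixOf A m n * f m)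
    (B := C * (n : ℝ) ^ c) (K := C * (n : ℝ) ^ c * (K * (C * (n : ℝ) ^ c) ^ κ))
    (by positivity) (by positivity) hsupp fun k hk => ?_).trans (le_of_eq ?_)
  · rw [norm_mul]
    have := hsupp k hk
    refine mul_le_mul (h2 k n) ((h3 k).trans ?_) (norm_nonneg _) (by positivity)
    gcongr
  · rw [Real.mul_rpow hC.le (by positivity), ← Real.rpow_mul hn.le, Real.rpow_add hn,
      Real.rpow_add hn]
    ring

theorem coeff_coe (f : ℕ+ → ℂ) (n : ℕ+) : coeff f n = f n := dif_pos n.pos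

theorem coeff_rightAct_eq_convolution {A : Module.End ℂ E} (hA : matrixOf A = divisorMatrix)
    (f : ℕ+ → ℂ) : coeff (rightAct f A) = LSeries.convolution (coeff f) 1 := by
  funext n
  rcases Nat.eq_zero_or_pos n with rfl | hn
  · rw [LSeries.convolution_map_zero]
    simp [coeff]
  · lift n to ℕ+ using hn
    have hM : ∀ i : ℕ+, matrixOf A i n = if (i : ℕ) ∣ n then 1 else 0 :=
      fun i => congrFun (congrFun hA i) n
    have hmem : ∀ i : ℕ+, i ∈ (A (Finsupp.single n 1)).support ↔ (i : ℕ) ∣ n := fun i => by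
      rw [Finsupp.mem_support_iff]
      change matrixOf A i n ≠ 0 ↔ _
      rw [hM]
      simp
    rw [LSeries.convolution_def, coeff_coe]
    simp only [Pi.one_apply, mul_one]
    rw [Nat.sum_divisorsAntidiagonal (f := fun d _ => coeff f d), rightAct]
    refine Finset.sum_bij (fun m _ => (m : ℕ)) (fun m hm => ?_) (fun _ _ _ _ h =>
      PNat.coe_injective h) (fun d hd => ?_) fun m hm => ?_
    · exact Nat.mem_divisors.mpr ⟨(hmem m).mp hm, n.ne_zero⟩
    · exact ⟨⟨d, Nat.pos_of_mem_divisors hd⟩, (hmem _).mpr (Nat.dvd_of_mem_divisors hd), rfl⟩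
    · rw [hM, if_pos ((hmem m).mp hm), one_mul, coeff_coe]

end DivisorMatrix

open DivisorMatrix in
theorem mainTheorem1 :
    ∃ ρ : Representation ℂ SL(2, ℤ) E,
      -- an exhaustive filtration by submodules with standard two-dimensional quotients
      (∃ F : ℕ → Subrepresentation ρ,
        F 0 = ⊥ ∧ StrictMono F ∧ (∀ v : E, ∃ i, v ∈ F i) ∧
        ∀ i, Nonempty (Representation.Equiv (subquotient (F i) (F (i + 1))) standardRep)) ∧
      matrixOf (ρ ModularGroup.T) = divisorMatrix ∧
      (∀ (Y : SL(2, ℤ)) (i j : ℕ+), ∃ z : ℤ, matrixOf (ρ Y) i j = z) ∧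
      (∀ Y : SL(2, ℤ), ρ Y ∈ DR0) ∧
      -- the right action on analytic Dirichlet series; `T` acts as multiplication by `ζ(s)`
      (∀ (Y : SL(2, ℤ)), ∀ f ∈ DS, rightAct f (ρ Y) ∈ DS) ∧
      (∀ (f : ℕ+ → ℂ) (s : ℂ), 1 < s.re → LSeriesSummable (coeff f) s →
        LSeriesSummable (coeff (rightAct f (ρ ModularGroup.T))) s ∧
        LSeries (coeff (rightAct f (ρ ModularGroup.T))) s =
          riemannZeta s * LSeries (coeff f) s) := by
  obtain ⟨ρ, hS, hT⟩ : ∃ ρ : Representation ℂ SL(2, ℤ) E,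
      ρ ModularGroup.S = opS ∧ ρ ModularGroup.T = 1 + divOp 1 :=
    exists_representation_of_locally_nilpotent (divOp_pow_apply_eq_zero 1) divOp_one_mul_rightInv
  have hD : matrixOf (ρ ModularGroup.T) = divisorMatrix := hT ▸ matrixOf_one_add_divOp
  have hDR0 : ∀ Y : SL(2, ℤ), ρ Y ∈ DR0 := rep_mem_of_mem hS hT opS_mem_DR0 divOp_one_mem_DR0
  let F : ℕ → Subrepresentation ρ := fun n =>
    ⟨filt n, fun g _ hv => rep_apply_mem_filt hS hT g hv⟩
  refine ⟨ρ, ⟨F, ?_, ?_, fun v => ?_, nonempty_equiv_standardRep hS hT F fun _ => rfl⟩, hD,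
    fun Y i j => ?_, hDR0, fun Y f hf => rightAct_mem_DS (hDR0 Y) hf, fun f s hs hf => ?_⟩
  · exact Subrepresentation.toSubmodule_injective filt_zero
  · exact fun a b hab => filt_strictMono hab
  · obtain ⟨n, hn⟩ := exists_mem_Lev v
    exact ⟨n, mem_filt_of_mem_Lev hn⟩
  · exact rep_mem_of_mem hS hT opS_mem_stab_intLattice (divOp_mem_stab_intLattice 1) Y _
      (single_mem_intLattice j) i
  · have h1 := LSeriesSummable_one_iff.mpr hs
    rw [coeff_rightAct_eq_convolution hD]
    refine ⟨hf.convolution h1, ?_⟩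
    rw [LSeries_convolution' hf h1, LSeries_one_eq_riemannZeta hs, mul_comm]
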